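/- Let $f(x)=x^4+ax^2+bx+c\in\mathbb Z[x]$ be irreducible, let $K=\mathbb Q(\theta)$ be the quartic number field generated by a root $\theta$ of $f$, let $\mathbb Z_K$ be its ring of integers, let $v_3$ be the $3$-adic valuation (with $v_3(0)=\infty$), and put $\Delta=v_3(\operatorname{disc}(f))$. Suppose that $a\equiv 0$ or $6\pmod 9$, $3\nmid b$ and $3\mid c$. For $s\in\mathbb Z$ write $f(x)=\sum_{i=0}^4 a_i(x-s)^i$ with $a_i\in\mathbb Z$, and let $u_i=v_3(a_i)$. The Newton polygon $N_{x-s}(f)$ is the lower convex envelope of the points $(i,u_i)$ with $a_i\neq0$. For a side of negative slope $-h/e$ ($h,e$ positive and coprime) of this polygon, with initial abscissa $i$ and length $de$, the residual polynomial is $\sum_{k=0}^{d}c_{i+ke}\,y^k\in\mathbb F_3[y]$, where $c_j$ is the class of $a_j/3^{u_j}$ modulo $3$ if $a_j\neq0$ and $(j,u_j)$ lies on the polygon, and $c_j=0$ otherwise. The integer $s$ is called regular if the residual polynomial of every side of negative slope of $N_{x-s}(f)$ is separable. Choose $s$ as follows. - If $v_3(f(-b))\le 2$ or $v_3(f'(-b))=1$,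 let $s=-b$. - If $v_3(f(-b))>2$ and $v_3(f'(-b))>1$, let $s$ be any integer with $s\equiv -b\pmod 3$ and $v_3(f'(s))>\Delta/2$ (such integers exist). Then $s$ is regular. Moreover, if $y_i$ denotes the ordinate of the point of $N_{x-s}(f)$ with abscissa $i$ and $\nu_i=\lfloor y_i\rfloor$ for $i=1,2$, then $$1,\qquad \theta,\qquad \frac{\theta^2+2s\theta+3s^2+a}{3^{\nu_2}},\qquad \frac{\theta^3+s\theta^2+(s^2+a)\theta+s^3+as+b}{3^{\nu_1}}$$ is a $3$-integral basis of $K$, that is, these are elements of $\mathbb Z_K$ which form a basis of the $\mathbb Z_{(3)}$-module $\mathbb Z_K\otimes_{\mathbb Z}\mathbb Z_{(3)}$. The values of $\nu_1,\nu_2$ are given by the following table, at least one row of which applies (a blank means no condition): $$\begin{array}{|c|c|c|c|}\hline v_3(f(s))&v_3(f'(s))&\nu_1&\nu_2\\\hline 1&&0&0\\\hline 2&&1&0\\\hline >1&1&1&0\\\hline >2&>1&\lfloor\Delta/2\rfloor-1&1\\\hline \end{array}$$ -/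

import Mathlib

open Polynomial

noncomputable section

/-- The quartic polynomial `x⁴ + a x² + b x + c`. -/
def quartic (a b c : ℤ) : ℤ[X] := X ^ 4 + C a * X ^ 2 + C b * X + C c

/-- The coefficient `a_i` of the development `f = ∑ a_i (x - s)^i`. -/
def devCoeff (f : ℤ[X]) (s : ℤ) (i : ℕ) : ℤ := (taylor s f).coeff i

/-- The points `(i, v_p(a_i))`, for `a_i ≠ 0`, attached to the `(x - s)`-adic development of `f`. -/
def newtonPoints (p : ℕ) (f : ℤ[X]) (s : ℤ) : Set (ℝ × ℝ) :=
  {P | ∃ i : ℕ, devCoeff f s i ≠ 0 ∧ P = ((i : ℝ), (padicValInt p (devCoeff f s i) : ℝ))}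

/-- The `(x - s)`-Newton polygon `N_{x-s}(f)`, as a function of the abscissa: the lower boundary
of the convex hull of the points `(i, v_p(a_i))`. It is meaningful for abscissas between the
first and the last abscissa of these points. -/
def newtonOrdinate (p : ℕ) (f : ℤ[X]) (s : ℤ) (x : ℝ) : ℝ :=
  sInf {y : ℝ | (x, y) ∈ convexHull ℝ (newtonPoints p f s)}

/-- The slope of the chord of the Newton polygon between the abscissas `i` and `j`, which are
meant to be abscissas of vertices (where the polygon passes through the attached points). -/
def newtonSlope (p : ℕ) (f : ℤ[X]) (s : ℤ) (i j : ℕ) : ℚ :=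
  ((padicValInt p (devCoeff f s j) : ℚ) - (padicValInt p (devCoeff f s i) : ℚ)) /
    ((j : ℚ) - (i : ℚ))

/-- `i < j` lie in the range of abscissas of the Newton polygon and the polygon is a straight
segment between the abscissas `i` and `j`. -/
def IsSegment (p : ℕ) (f : ℤ[X]) (s : ℤ) (i j : ℕ) : Prop :=
  (taylor s f).natTrailingDegree ≤ i ∧ i < j ∧ j ≤ (taylor s f).natDegree ∧
    ∃ m : ℝ, ∀ x ∈ Set.Icc (i : ℝ) (j : ℝ),
      newtonOrdinate p f s x = newtonOrdinate p f s i + m * (x - i)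

/-- The Newton polygon has a side with initial abscissa `i` and final abscissa `j`: a maximal
segment of the polygon (the end points of the sides always have integral abscissa). -/
def IsSide (p : ℕ) (f : ℤ[X]) (s : ℤ) (i j : ℕ) : Prop :=
  IsSegment p f s i j ∧
    ∀ i' j' : ℕ, i' ≤ i → j ≤ j' → IsSegment p f s i' j' → i' = i ∧ j' = j

open Classical in
/-- The residual coefficient `c_i ∈ 𝔽_p`: the class of `a_i / p^{v_p(a_i)}` if the point
`(i, v_p(a_i))` lies on the Newton polygon, and `0` otherwise. -/
def residualCoeff (p : ℕ) (f : ℤ[X]) (s : ℤ) (i : ℕ) : ZMod p :=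
  if devCoeff f s i ≠ 0 ∧
      (padicValInt p (devCoeff f s i) : ℝ) = newtonOrdinate p f s i then
    ((devCoeff f s i / (p : ℤ) ^ padicValInt p (devCoeff f s i) : ℤ) : ZMod p)
  else 0

/-- The residual polynomial `c_i + c_{i+e} y + ⋯ + c_{i+de} y^d` of the side from abscissa `i` to
abscissa `j`, where `e` is the denominator of the slope and `d = (j - i) / e` is the degree. -/
def residualPoly (p : ℕ) (f : ℤ[X]) (s : ℤ) (i j : ℕ) : (ZMod p)[X] :=
  ∑ k ∈ Finset.range ((j - i) / (newtonSlope p f s i j).den + 1),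
    C (residualCoeff p f s (i + k * (newtonSlope p f s i j).den)) * X ^ k

/-- `f` is `(x - s)`-regular: the residual polynomial of every side of negative slope of the
`(x - s)`-Newton polygon is separable. -/
def IsRegularAt (p : ℕ) (f : ℤ[X]) (s : ℤ) : Prop :=
  ∀ i j : ℕ, IsSide p f s i j → newtonSlope p f s i j < 0 → (residualPoly p f s i j).Separable

/-- A `p`-integral basis of `K`: a family of elements of the ring of integers `ℤ_K` which is a
basis of the `ℤ_(p)`-module `ℤ_K ⊗ ℤ_(p)`. Here `ℤ_(p)` is the ring of the rational numbers with
denominator prime to `p`. -/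
def IsPIntegralBasis (p : ℕ) {K : Type*} [Field K] [NumberField K] {ι : Type*} [Fintype ι]
    (α : ι → K) : Prop :=
  (∀ i, IsIntegral ℤ (α i)) ∧ LinearIndependent ℚ α ∧
    ∀ x : K, IsIntegral ℤ x → ∃ r : ι → ℚ, (∀ i, ¬ p ∣ (r i).den) ∧ x = ∑ i, r i • α i

/-- The family `1`, `θ`, `(θ² + 2sθ + 3s² + a) / p^{ν₂}`,
`(θ³ + sθ² + (s² + a)θ + s³ + as + b) / p^{ν₁}`. -/
def tripleFamily (p : ℕ) {K : Type*} [Field K] (a b s : ℤ) (θ : K) (ν₁ ν₂ : ℤ) : Fin 4 → K :=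
  ![1, θ,
    (θ ^ 2 + 2 * (s : K) * θ + 3 * (s : K) ^ 2 + (a : K)) / (p : K) ^ ν₂,
    (θ ^ 3 + (s : K) * θ ^ 2 + ((s : K) ^ 2 + (a : K)) * θ + (s : K) ^ 3 + (a : K) * (s : K)
      + (b : K)) / (p : K) ^ ν₁]

/-- The `p`-adic valuation on `ℤ`, with `v_p(0) = ∞`. -/
def val (p : ℕ) (n : ℤ) : ℕ∞ := emultiplicity (p : ℤ) n

/-- The first case: `v₃(f(-b)) ≤ 2` or `v₃(f'(-b)) = 1`. -/
def FirstCase (a b c : ℤ) : Prop :=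
  val 3 ((quartic a b c).eval (-b)) ≤ 2 ∨ val 3 ((derivative (quartic a b c)).eval (-b)) = 1

/-- The second case: `v₃(f(-b)) > 2` and `v₃(f'(-b)) > 1`. -/
def SecondCase (a b c : ℤ) : Prop :=
  2 < val 3 ((quartic a b c).eval (-b)) ∧ 1 < val 3 ((derivative (quartic a b c)).eval (-b))

/-- `Δ = v₃(disc f)`. -/
def discVal (a b c : ℤ) : ℕ := padicValInt 3 (quartic a b c).discr

/-- `s ≡ -b (mod 3)` and `v₃(f'(s)) > Δ / 2`. -/
def IsGoodLift (a b c s : ℤ) : Prop :=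
  s ≡ -b [ZMOD 3] ∧
    (discVal a b c : ℕ∞) < 2 * val 3 ((derivative (quartic a b c)).eval s)

end

/-! Modulo 3 one has f ≡ x(x + b)³. For s ≡ -b the development at s therefore has a₄ = 1, a₃ = 4s a
unit, and 3 dividing a₀ and a₁; since s² ≡ 1 mod 3, the condition on a modulo 9 gives v(a₂) = 1
exactly. Only n = v(a₀) and m = v(a₁) remain free, and four shapes occur: n = 1 (one side of slope
-1/3); n = 2, m ≥ 2 (slope -2/3); n ≥ 2, m = 1 (vertex at abscissa 1); n ≥ 3, m ≥ 2.

The last shape is the delicate one. There 2m > n + 3, for otherwise 3^(2m) would divide disc(f),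
against Δ < 2m (`exists_pow_dvd_of_isGoodLift`, `pow_dvd_discr`). Hence (1, m) lies strictly above
the chord from (0, n) to (2, 1), the residual coefficient at 1 vanishes, and the residual
polynomials are separable in characteristic 3. Moreover -4a₃²a₂³a₀ dominates the discriminant, so Δ
= n + 3.

For the basis put η = θ - s. The two numerators are the Horner quotients of f at η. The cubic one,
q, satisfies ηq = -a₀, so reversing the equation of η gives one for q, whose coefficients show how
far q can be divided by 3 (`isIntegral_cubic_quotient_div`). In the last two shapes the discriminant
of the family has 3-adic valuation at most 1, which forces a 3-integral basis
(`isPIntegralBasis_of_discr`). In the first two shapes ramification leaves a factor 9 in that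
discriminant, and saturation is proved directly (`isPIntegralBasis_of_saturated`): one homomorphism
to a field of characteristic 3 kills η, another does not, and applying them in turn to a relation 3z
= ∑ rᵢαᵢ shows that 3 divides each rᵢ. -/

lemma quartic_natDegree (a b c : ℤ) : (quartic a b c).natDegree = 4 := by
  unfold quartic; compute_degree!

/-- Up to sign `discr` is the determinant of this matrix; its index types depend on `natDegree`, so
it is moved to `Fin 7` before expansion. -/
lemma sylvesterDeriv_quartic (a b c : ℤ) :
    (quartic a b c).sylvesterDeriv.reindex (finCongr <| by rw [quartic_natDegree])
      (finCongr <| by rw [quartic_natDegree]) =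
    !![c, 0, 0, b, 0, 0, 0;
       b, c, 0, 2 * a, b, 0, 0;
       a, b, c, 0, 2 * a, b, 0;
       0, a, b, 4, 0, 2 * a, b;
       1, 0, a, 0, 4, 0, 2 * a;
       0, 1, 0, 0, 0, 4, 0;
       0, 0, 1, 0, 0, 0, (4 : ℤ)] := by
  have hf := quartic_natDegree a b c
  have h0 : (quartic a b c).coeff 0 = c := by simp [quartic]
  have h1 : (quartic a b c).coeff 1 = b := by simp [quartic, coeff_C, -eq_intCast]
  have h2 : (quartic a b c).coeff 2 = a := by simp [quartic, -eq_intCast]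
  have h3 : (quartic a b c).coeff 3 = 0 := by simp [quartic, -eq_intCast]
  have h4 : (quartic a b c).coeff 4 = 1 := by simp [quartic, -eq_intCast]
  ext ⟨i, hi⟩ ⟨j, hj⟩
  simp only [sylvesterDeriv, hf, OfNat.ofNat_ne_zero, ↓reduceDIte, sylvester, Fin.addCases,
    Nat.add_one_sub_one, Fin.val_castLT, Set.mem_Icc, Fin.val_fin_le, Fin.val_subNat, Fin.val_cast,
    tsub_le_iff_right, coeff_derivative, eq_rec_constant, dite_eq_ite, Nat.reduceMul, Nat.reduceSub,
    Nat.cast_ofNat, Matrix.reindex_apply, finCongr_symm, Matrix.submatrix_apply, finCongr_apply,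
    Fin.cast_mk, Matrix.updateRow_apply, Fin.mk.injEq, Matrix.of_apply, Fin.mk_le_mk,
    Matrix.cons_val', Matrix.cons_val_fin_one]
  have hi' : i ∈ Finset.range 7 := Finset.mem_range.mpr hi
  have hj' : j ∈ Finset.range 7 := Finset.mem_range.mpr hj
  fin_cases hi' <;>
  · simp only [and_true, Fin.isValue, Fin.mk_one, Fin.reduceFinMk, Fin.zero_eta,
      le_add_iff_nonneg_left, Matrix.cons_val_one, Matrix.cons_val_zero, Matrix.cons_val,
      Nat.reduceAdd, Nat.reduceEqDiff, Nat.reduceLeDiff, nonpos_iff_eq_zero,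
      OfNat.one_ne_ofNat, ↓reduceIte, zero_add, zero_le]
    fin_cases hj' <;> simp [mul_comm, h0, h1, h2, h3, h4]

lemma discr_quartic (a b c : ℤ) : (quartic a b c).discr =
    16 * a ^ 4 * c - 4 * a ^ 3 * b ^ 2 - 128 * a ^ 2 * c ^ 2 + 144 * a * b ^ 2 * c
      - 27 * b ^ 4 + 256 * c ^ 3 := by
  have hf := quartic_natDegree a b c
  let e : Fin ((quartic a b c).natDegree - 1 + (quartic a b c).natDegree) ≃ Fin 7 :=
    finCongr (by rw [hf])
  rw [discr, ← Matrix.det_reindex_self e, sylvesterDeriv_quartic a b c, hf]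
  simp [Matrix.det_succ_row_zero, Fin.succAbove, Fin.sum_univ_succ]
  ring

/-! ### Values and Taylor coefficients of the quartic -/

lemma eval_quartic (a b c s : ℤ) :
    (quartic a b c).eval s = s ^ 4 + a * s ^ 2 + b * s + c := by
  simp [quartic]

lemma eval_derivative_quartic (a b c s : ℤ) :
    (derivative (quartic a b c)).eval s = 4 * s ^ 3 + 2 * a * s + b := by
  simp [quartic]
  ring

lemma taylor_quartic (a b c s : ℤ) : taylor s (quartic a b c) =
    X ^ 4 + C (4 * s) * X ^ 3 + C (6 * s ^ 2 + a) * X ^ 2 + C (4 * s ^ 3 + 2 * a * s + b) * X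
      + C (s ^ 4 + a * s ^ 2 + b * s + c) := by
  simp [quartic, taylor_apply, -eq_intCast]
  simp only [C_ofNat]
  ring

lemma devCoeff_quartic_zero (a b c s : ℤ) :
    devCoeff (quartic a b c) s 0 = s ^ 4 + a * s ^ 2 + b * s + c := by
  simp [devCoeff, taylor_quartic, -eq_intCast, -map_add, -map_mul]

lemma devCoeff_quartic_one (a b c s : ℤ) :
    devCoeff (quartic a b c) s 1 = 4 * s ^ 3 + 2 * a * s + b := by
  simp [devCoeff, taylor_quartic, coeff_C, -eq_intCast, -map_add, -map_mul]

lemma devCoeff_quartic_two (a b c s : ℤ) :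
    devCoeff (quartic a b c) s 2 = 6 * s ^ 2 + a := by
  simp [devCoeff, taylor_quartic, -eq_intCast, -map_add, -map_mul]

lemma devCoeff_quartic_three (a b c s : ℤ) : devCoeff (quartic a b c) s 3 = 4 * s := by
  simp [devCoeff, taylor_quartic, -eq_intCast, -map_add, -map_mul]

lemma devCoeff_quartic_four (a b c s : ℤ) : devCoeff (quartic a b c) s 4 = 1 := by
  simp [devCoeff, taylor_quartic, -eq_intCast, -map_add, -map_mul]

lemma quartic_monic (a b c : ℤ) : (quartic a b c).Monic := by
  unfold quartic; monicity!

/-! ### Power basis, traces and discriminant of the quartic field -/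

section QuarticField

variable {K : Type*} [Field K] {a b c : ℤ} {θ : K}

lemma aeval_quartic {R : Type*} [CommRing R] (a b c : ℤ) (θ : R) :
    aeval θ (quartic a b c) = θ ^ 4 + a * θ ^ 2 + b * θ + c := by
  simp [quartic]

lemma isIntegral_of_aeval_quartic (hθ : aeval θ (quartic a b c) = 0) : IsIntegral ℤ θ :=
  ⟨quartic a b c, quartic_monic a b c, hθ⟩

variable [NumberField K]

lemma minpoly_of_aeval_quartic (hf : Irreducible (quartic a b c))
    (hθ : aeval θ (quartic a b c) = 0) :
    minpoly ℚ θ = (quartic a b c).map (algebraMap ℤ ℚ) := by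
  refine (minpoly.eq_of_irreducible_of_monic ?_ ?_ ((quartic_monic a b c).map _)).symm
  · exact ((quartic_monic a b c).irreducible_iff_irreducible_map_fraction_map).1 hf
  · rwa [aeval_map_algebraMap]

/-- The power basis `1, θ, θ², θ³` of the quartic field `ℚ(θ)`. -/
lemma exists_basis_pow (hf : Irreducible (quartic a b c)) (hθ : aeval θ (quartic a b c) = 0)
    (hK : IntermediateField.adjoin ℚ {θ} = ⊤) :
    ∃ B : Module.Basis (Fin 4) ℚ K, ∀ i, B i = θ ^ (i : ℕ) := by
  have hint : IsIntegral ℚ θ := (isIntegral_of_aeval_quartic hθ).tower_top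
  have htop : Algebra.adjoin ℚ {θ} = ⊤ :=
    Algebra.adjoin_eq_top_of_intermediateField
      (fun x hx => by rw [Set.mem_singleton_iff.1 hx]; exact hint.isAlgebraic) hK
  let pb := PowerBasis.ofAdjoinEqTop hint htop
  have hdim : pb.dim = 4 := by
    rw [PowerBasis.ofAdjoinEqTop_dim, minpoly_of_aeval_quartic hf hθ,
      (quartic_monic a b c).natDegree_map, quartic_natDegree]
  refine ⟨pb.basis.reindex (finCongr hdim), fun i => ?_⟩
  rw [Module.Basis.reindex_apply, PowerBasis.basis_eq_pow]
  rfl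

variable {B : Module.Basis (Fin 4) ℚ K}

lemma repr_cubic (hB : ∀ i, B i = θ ^ (i : ℕ)) (r₀ r₁ r₂ r₃ : ℚ) :
    ⇑(B.repr ((r₀ : K) + r₁ * θ + r₂ * θ ^ 2 + r₃ * θ ^ 3)) = ![r₀, r₁, r₂, r₃] := by
  have h : (r₀ : K) + r₁ * θ + r₂ * θ ^ 2 + r₃ * θ ^ 3 = ∑ i, ![r₀, r₁, r₂, r₃] i • B i := by
    simp [Fin.sum_univ_four, hB, Algebra.smul_def]
  rw [h, B.repr_sum_self]

lemma trace_eq_sum_repr (x : K) : Algebra.trace ℚ K x = ∑ i, B.repr (x * B i) i := by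
  simp [Algebra.trace_eq_matrix_trace B, Matrix.trace, Algebra.leftMulMatrix_eq_repr_mul]

/-- These are the entries of the trace matrix of the power basis. Exponents up to 3 come from
coordinates, the others from Newton's recurrence θ⁴ = -aθ² - bθ - c. -/
lemma trace_pow_of_quartic (hB : ∀ i, B i = θ ^ (i : ℕ)) (hθ : aeval θ (quartic a b c) = 0) :
    Algebra.trace ℚ K 1 = 4 ∧ Algebra.trace ℚ K θ = 0 ∧ Algebra.trace ℚ K (θ ^ 2) = -2 * a ∧
      Algebra.trace ℚ K (θ ^ 3) = -3 * b ∧ Algebra.trace ℚ K (θ ^ 4) = 2 * a ^ 2 - 4 * c ∧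
      Algebra.trace ℚ K (θ ^ 5) = 5 * a * b ∧
      Algebra.trace ℚ K (θ ^ 6) = -2 * a ^ 3 + 3 * b ^ 2 + 6 * a * c := by
  rw [aeval_quartic] at hθ
  have e4 : θ ^ 4 = ((-c : ℚ) : K) + (-b : ℚ) * θ + (-a : ℚ) * θ ^ 2 + (0 : ℚ) * θ ^ 3 := by
    push_cast; linear_combination hθ
  have e5 : θ ^ 5 = ((0 : ℚ) : K) + (-c : ℚ) * θ + (-b : ℚ) * θ ^ 2 + (-a : ℚ) * θ ^ 3 := by
    push_cast; linear_combination θ * hθ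
  have e6 : θ ^ 6 = ((a * c : ℚ) : K) + (a * b : ℚ) * θ + (a ^ 2 - c : ℚ) * θ ^ 2
      + (-b : ℚ) * θ ^ 3 := by
    push_cast; linear_combination (θ ^ 2 - a) * hθ
  have r0 := repr_cubic hB 1 0 0 0
  have r1 := repr_cubic hB 0 1 0 0
  have r2 := repr_cubic hB 0 0 1 0
  have r3 := repr_cubic hB 0 0 0 1
  have r4 := repr_cubic hB (-c) (-b) (-a) 0
  have r5 := repr_cubic hB 0 (-c) (-b) (-a)
  have r6 := repr_cubic hB (a * c) (a * b) (a ^ 2 - c) (-b)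
  rw [← e4] at r4
  rw [← e5] at r5
  rw [← e6] at r6
  simp only [Rat.cast_one, Rat.cast_zero, zero_mul, one_mul, add_zero, zero_add] at r0 r1 r2 r3
  have t0 : Algebra.trace ℚ K 1 = 4 := by
    rw [trace_eq_sum_repr (B := B)]
    simp
  have t1 : Algebra.trace ℚ K θ = 0 := by
    rw [trace_eq_sum_repr (B := B)]
    simp [Fin.sum_univ_four, hB, ← pow_succ', r1, r2, r3, r4]
  have t2 : Algebra.trace ℚ K (θ ^ 2) = -2 * a := by
    rw [trace_eq_sum_repr (B := B)]
    simp [Fin.sum_univ_four, hB, ← pow_add, r2, r3, r4, r5]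
    ring
  have t3 : Algebra.trace ℚ K (θ ^ 3) = -3 * b := by
    rw [trace_eq_sum_repr (B := B)]
    simp [Fin.sum_univ_four, hB, ← pow_add, r3, r4, r5, r6]
    ring
  have lin : ∀ (r s t : ℤ) (x y z : K), Algebra.trace ℚ K (r * x + s * y + t * z) =
      r * Algebra.trace ℚ K x + s * Algebra.trace ℚ K y + t * Algebra.trace ℚ K z := by
    intro r s t x y z
    have h : (r : K) * x + s * y + t * z = (r : ℚ) • x + (s : ℚ) • y + (t : ℚ) • z := by
      simp [Algebra.smul_def]
    rw [h]
    simp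
  have t4 : Algebra.trace ℚ K (θ ^ 4) = 2 * a ^ 2 - 4 * c := by
    have h : θ ^ 4 = ((-a : ℤ) : K) * θ ^ 2 + ((-b : ℤ) : K) * θ + ((-c : ℤ) : K) * 1 := by
      push_cast; linear_combination hθ
    rw [h, lin, t0, t1, t2]; push_cast; ring
  have t5 : Algebra.trace ℚ K (θ ^ 5) = 5 * a * b := by
    have h : θ ^ 5 = ((-a : ℤ) : K) * θ ^ 3 + ((-b : ℤ) : K) * θ ^ 2 + ((-c : ℤ) : K) * θ := by
      push_cast; linear_combination θ * hθ
    rw [h, lin, t1, t2, t3]; push_cast; ring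
  have t6 : Algebra.trace ℚ K (θ ^ 6) = -2 * a ^ 3 + 3 * b ^ 2 + 6 * a * c := by
    have h : θ ^ 6 = ((-a : ℤ) : K) * θ ^ 4 + ((-b : ℤ) : K) * θ ^ 3 + ((-c : ℤ) : K) * θ ^ 2 := by
      push_cast; linear_combination θ ^ 2 * hθ
    rw [h, lin, t2, t3, t4]; push_cast; ring
  exact ⟨t0, t1, t2, t3, t4, t5, t6⟩

/-- Bridge from the discriminant of the polynomial to that of the field basis: both are expanded as
polynomials in a, b, c. -/
lemma algebra_discr_pow (hB : ∀ i, B i = θ ^ (i : ℕ)) (hθ : aeval θ (quartic a b c) = 0) :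
    Algebra.discr ℚ B = (quartic a b c).discr := by
  obtain ⟨t0, t1, t2, t3, t4, t5, t6⟩ := trace_pow_of_quartic hB hθ
  have h : Algebra.traceMatrix ℚ B =
      (!![4, 0, -2 * a, -3 * b;
         0, -2 * a, -3 * b, 2 * a ^ 2 - 4 * c;
         -2 * a, -3 * b, 2 * a ^ 2 - 4 * c, 5 * a * b;
         -3 * b, 2 * a ^ 2 - 4 * c, 5 * a * b, -2 * a ^ 3 + 3 * b ^ 2 + 6 * a * c] :
        Matrix (Fin 4) (Fin 4) ℚ) := by
    ext i j
    rw [Algebra.traceMatrix_apply, Algebra.traceForm_apply, hB, hB, ← pow_add]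
    fin_cases i <;> fin_cases j <;> simp [t0, t1, t2, t3, t4, t5, t6]
  rw [Algebra.discr_def, h, discr_quartic]
  simp [Matrix.det_succ_row_zero, Fin.succAbove, Fin.sum_univ_succ]
  ring

end QuarticField

/-! ### Two criteria for p-integral bases -/

section PIntegralBasis

variable {K : Type*} [Field K] [NumberField K] {ι : Type*} [Fintype ι] {p : ℕ}

lemma exists_rat_coeff {α : ι → K} (hα : LinearIndependent ℚ α)
    (hcard : Fintype.card ι = Module.finrank ℚ K) (x : K) : ∃ r : ι → ℚ, x = ∑ i, r i • α i := by
  classical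
  rcases isEmpty_or_nonempty ι with hι | hι
  · rw [Fintype.card_eq_zero] at hcard
    exact absurd hcard Module.finrank_pos.ne
  · refine ⟨(basisOfLinearIndependentOfCardEqFinrank hα hcard).repr x, ?_⟩
    conv_lhs => rw [← (basisOfLinearIndependentOfCardEqFinrank hα hcard).sum_repr x]
    simp

/-- A family of integers of `K` whose discriminant is nonzero and not divisible by `p ^ 2` is a
`p`-integral basis. -/
lemma isPIntegralBasis_of_discr [DecidableEq ι] {α : ι → K}
    (hα : ∀ i, IsIntegral ℤ (α i)) (hcard : Fintype.card ι = Module.finrank ℚ K) {D : ℤ}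
    (hD : Algebra.discr ℚ α = D) (hpD : ¬ (p : ℤ) ^ 2 ∣ D) : IsPIntegralBasis p α := by
  have hli : LinearIndependent ℚ α := by
    by_contra h
    have h0 := Algebra.discr_zero_of_not_linearIndependent ℚ (b := α) h
    rw [h0] at hD
    exact hpD (by rw [Int.cast_eq_zero.1 hD.symm]; exact dvd_zero _)
  refine ⟨hα, hli, fun x hx => ?_⟩
  obtain ⟨r, hr⟩ := exists_rat_coeff hli hcard x
  refine ⟨r, fun i hi => hpD ?_, hr⟩
  -- Replacing α i by x has transition determinant r i, so it multiplies the discriminant by (r i)².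
  -- The result is integral, hence (r i)² D ∈ ℤ, and p in the denominator of r i would force p² ∣ D.
  have hvec : Matrix.vecMul α (((1 : Matrix ι ι ℚ).updateCol i r).map (algebraMap ℚ K)) =
      Function.update α i x := by
    ext j
    rw [Matrix.vecMul, dotProduct]
    rcases eq_or_ne j i with rfl | hj
    · simp [hr, Algebra.smul_def, mul_comm]
    · simp [hj, Matrix.one_apply]
  have hdisc := Algebra.discr_of_matrix_vecMul α ((1 : Matrix ι ι ℚ).updateCol i r)
  rw [hvec, ← Matrix.cramer_apply, Matrix.cramer_one, Module.End.one_apply, hD] at hdisc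
  have hint : IsIntegral ℤ (Algebra.discr ℚ (Function.update α i x)) := by
    refine Algebra.discr_isIntegral ℚ fun j => ?_
    rcases eq_or_ne j i with rfl | hj
    · simpa using hx
    · simpa [hj] using hα j
  obtain ⟨N, hN⟩ := IsIntegrallyClosed.isIntegral_iff.1 hint
  rw [hdisc, eq_intCast] at hN
  have hden : ((r i).den : ℚ) ≠ 0 := by exact_mod_cast (r i).den_ne_zero
  have hZ : (r i).num ^ 2 * D = N * ((r i).den : ℤ) ^ 2 := by
    have h : (r i) * (r i).den = (r i).num := Rat.mul_den_eq_num _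
    have : ((r i).num : ℚ) ^ 2 * D = N * ((r i).den : ℚ) ^ 2 := by
      rw [← h, hN]; ring
    exact_mod_cast this
  have hcop : IsCoprime ((p : ℤ) ^ 2) ((r i).num ^ 2) := by
    refine IsCoprime.pow ?_
    refine Int.isCoprime_iff_gcd_eq_one.2 ?_
    rw [Int.gcd_eq_natAbs, Int.natAbs_natCast]
    exact Nat.Coprime.coprime_dvd_left hi (r i).reduced.symm
  refine hcop.dvd_of_dvd_mul_left ?_
  rw [hZ]
  exact Dvd.dvd.mul_left (pow_dvd_pow_of_dvd (by exact_mod_cast hi) 2) _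

/-- A linearly independent family of integers of `K` is a `p`-integral basis if it generates a
`p`-saturated subgroup of the ring of integers. -/
lemma isPIntegralBasis_of_saturated (hp : p.Prime) {α : ι → K}
    (hα : ∀ i, IsIntegral ℤ (α i)) (hcard : Fintype.card ι = Module.finrank ℚ K)
    (hli : LinearIndependent ℚ α)
    (hsat : ∀ (R : ι → ℤ) (z : K), IsIntegral ℤ z → (p : K) * z = ∑ i, (R i : K) * α i →
      ∀ i, (p : ℤ) ∣ R i) : IsPIntegralBasis p α := by
  have hpK : (p : K) ≠ 0 := by exact_mod_cast hp.ne_zero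
  -- Saturation at p iterates to saturation at every power of p, by dividing the coefficients by p
  -- once per step.
  have hsat' : ∀ (k : ℕ) (R : ι → ℤ) (z : K), IsIntegral ℤ z →
      (p : K) ^ k * z = ∑ i, (R i : K) * α i → ∀ i, (p : ℤ) ^ k ∣ R i := by
    intro k
    induction k with
    | zero => simp
    | succ k ih =>
      intro R z hz h
      have hpz : IsIntegral ℤ ((p : K) ^ k * z) :=
        (IsIntegral.pow (by simpa using isIntegral_algebraMap (R := ℤ) (x := (p : ℤ))) k).mul hz
      choose S hS using hsat R _ hpz (by rw [← mul_assoc, ← pow_succ', h])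
      have h' : (p : K) ^ k * z = ∑ i, (S i : K) * α i := by
        refine mul_left_cancel₀ hpK ?_
        rw [← mul_assoc, ← pow_succ', h, Finset.mul_sum]
        refine Finset.sum_congr rfl fun i _ => ?_
        rw [hS i]; push_cast; ring
      intro i
      rw [hS i, pow_succ']
      exact mul_dvd_mul_left _ (ih S z hz h' i)
  refine ⟨hα, hli, fun x hx => ?_⟩
  obtain ⟨r, hr⟩ := exists_rat_coeff hli hcard x
  obtain ⟨D, hD0, hD⟩ : ∃ D : ℕ, D ≠ 0 ∧ ∀ i, ∃ m : ℤ, (D : ℚ) * r i = m := by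
    refine ⟨∏ i, (r i).den, Finset.prod_ne_zero_iff.2 fun i _ => (r i).den_ne_zero, fun i => ?_⟩
    obtain ⟨k, hk⟩ := Finset.dvd_prod_of_mem (fun i => (r i).den) (Finset.mem_univ i)
    refine ⟨k * (r i).num, ?_⟩
    rw [hk]
    push_cast
    rw [← Rat.mul_den_eq_num]
    ring
  choose R hR using hD
  -- Only the p-part of the common denominator matters: the prime-to-p factor d is absorbed into x.
  obtain ⟨k, d, hpd, hDk⟩ := Nat.exists_eq_pow_mul_and_not_dvd hD0 p hp.ne_one
  have hmul : (p : K) ^ k * (d * x) = ∑ i, (R i : K) * α i := by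
    have h1 : (p : K) ^ k * (d * x) = (D : K) * x := by rw [hDk]; push_cast; ring
    rw [h1, hr, Finset.mul_sum]
    refine Finset.sum_congr rfl fun i _ => ?_
    have h2 : (R i : K) = algebraMap ℚ K (R i) := by simp
    rw [h2, ← hR i, Algebra.smul_def]
    simp [mul_assoc]
  have hdx : IsIntegral ℤ ((d : K) * x) :=
    IsIntegral.mul (by simpa using isIntegral_algebraMap (R := ℤ) (x := (d : ℤ))) hx
  choose S hS using hsat' k R _ hdx hmul
  refine ⟨r, fun i hi => hpd ?_, hr⟩
  have hpk : (p : ℚ) ^ k ≠ 0 := pow_ne_zero _ (by exact_mod_cast hp.ne_zero)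
  have hd : (d : ℚ) * r i = S i := by
    refine mul_left_cancel₀ hpk ?_
    have := hR i
    rw [hS i, hDk] at this
    push_cast at this
    rw [← this]; ring
  have hZ : (d : ℤ) * (r i).num = S i * (r i).den := by
    have h := Rat.mul_den_eq_num (r i)
    have : (d : ℚ) * (r i).num = S i * (r i).den := by rw [← hd, ← h]; ring
    exact_mod_cast this
  have hcop : IsCoprime (p : ℤ) (r i).num := by
    refine Int.isCoprime_iff_gcd_eq_one.2 ?_
    rw [Int.gcd_eq_natAbs, Int.natAbs_natCast]
    exact Nat.Coprime.coprime_dvd_left hi (r i).reduced.symm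
  have : (p : ℤ) ∣ d := by
    refine hcop.dvd_of_dvd_mul_right ?_
    rw [hZ]
    exact Dvd.dvd.mul_left (by exact_mod_cast hi) _
  exact_mod_cast this

end PIntegralBasis

/-! ### Integrality of the divided Horner quotients -/

section Integrality

variable {K : Type*} [Field K] [CharZero K] {η : K} {a₀ a₁ a₂ a₃ : ℤ}

/-- With `q = η³ + a₃η² + a₂η + a₁` one has `qη = -a₀`, so the reciprocal polynomial of the equation
of `η` gives an equation for `q`. -/
lemma isIntegral_cubic_quotient_div (h : η ^ 4 + a₃ * η ^ 3 + a₂ * η ^ 2 + a₁ * η + a₀ = 0)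
    (h₀ : a₀ ≠ 0) {ν : ℕ} (h1 : (3 : ℤ) ^ ν ∣ a₁) (h2 : (3 : ℤ) ^ (2 * ν) ∣ a₂ * a₀)
    (h3 : (3 : ℤ) ^ (3 * ν) ∣ a₃ * a₀ ^ 2) (h4 : (3 : ℤ) ^ (4 * ν) ∣ a₀ ^ 3) :
    IsIntegral ℤ ((η ^ 3 + a₃ * η ^ 2 + a₂ * η + a₁) / (3 : K) ^ ν) := by
  obtain ⟨b₁, h1⟩ := h1
  obtain ⟨b₂, h2⟩ := h2
  obtain ⟨b₃, h3⟩ := h3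
  obtain ⟨b₄, h4⟩ := h4
  have hη : η ≠ 0 := by
    rintro rfl
    apply h₀
    have : (a₀ : K) = 0 := by linear_combination h
    exact_mod_cast this
  have hq : η * (η ^ 3 + a₃ * η ^ 2 + a₂ * η + a₁) = -a₀ := by linear_combination h
  set q := η ^ 3 + a₃ * η ^ 2 + a₂ * η + a₁ with hqdef
  have hq4 : q ^ 4 - a₁ * q ^ 3 + (a₂ * a₀ : ℤ) * q ^ 2 - (a₃ * a₀ ^ 2 : ℤ) * q
      + (a₀ ^ 3 : ℤ) = 0 := by
    -- After multiplication by η⁴ every qⁱ becomes a power of ηq = -a₀, and the left side is a₀³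
    -- times the equation of η.
    refine (mul_eq_zero.1 (?_ : η ^ 4 * _ = 0)).resolve_left (pow_ne_zero 4 hη)
    have e4 : (η * q) ^ 4 = (-a₀ : K) ^ 4 := by rw [hq]
    have e3 : (η * q) ^ 3 = (-a₀ : K) ^ 3 := by rw [hq]
    have e2 : (η * q) ^ 2 = (-a₀ : K) ^ 2 := by rw [hq]
    push_cast
    linear_combination e4 - a₁ * η * e3 + a₂ * a₀ * η ^ 2 * e2 - a₃ * a₀ ^ 2 * η ^ 3 * hq
      + a₀ ^ 3 * h
  have h3K : (3 : K) ^ ν ≠ 0 := pow_ne_zero _ three_ne_zero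
  refine ⟨X ^ 4 - C b₁ * X ^ 3 + C b₂ * X ^ 2 - C b₃ * X + C b₄, by monicity!, ?_⟩
  rw [h1, h2, h3, h4] at hq4
  push_cast at hq4
  simp only [eval₂_add, eval₂_sub, eval₂_mul, eval₂_pow, eval₂_X, eval₂_C, algebraMap_int_eq,
    Int.coe_castRingHom]
  obtain ⟨z, hz⟩ : ∃ z, q = (3 : K) ^ ν * z := ⟨q / 3 ^ ν, by field_simp⟩
  rw [hz] at hq4 ⊢
  rw [mul_div_cancel_left₀ _ h3K]
  refine (mul_eq_zero.1 (?_ : ((3 : K) ^ ν) ^ 4 * _ = 0)).resolve_left (pow_ne_zero 4 h3K)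
  linear_combination hq4

/-- With g the quadratic quotient over 3 and ρ the cubic one over 9, ηg = 3(ρ - b₁) and ηρ = -b₀. So
g² - b₂g = gη(η + a₃)/3 = (ρ - b₁)(η + a₃) is integral, and g is integral over the integral
elements. -/
lemma isIntegral_quadratic_quotient_div
    (h : η ^ 4 + a₃ * η ^ 3 + a₂ * η ^ 2 + a₁ * η + a₀ = 0) (h₀ : (9 : ℤ) ∣ a₀)
    (h₁ : (9 : ℤ) ∣ a₁) (h₂ : (3 : ℤ) ∣ a₂)
    (hq : IsIntegral ℤ ((η ^ 3 + a₃ * η ^ 2 + a₂ * η + a₁) / 9)) :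
    IsIntegral ℤ ((η ^ 2 + a₃ * η + a₂) / 3) := by
  have hη : IsIntegral ℤ η := by
    refine ⟨X ^ 4 + C a₃ * X ^ 3 + C a₂ * X ^ 2 + C a₁ * X + C a₀, by monicity!, ?_⟩
    simpa only [eval₂_add, eval₂_mul, eval₂_pow, eval₂_X, eval₂_C, algebraMap_int_eq,
      Int.coe_castRingHom] using h
  obtain ⟨b₀, rfl⟩ := h₀
  obtain ⟨b₁, rfl⟩ := h₁
  obtain ⟨b₂, rfl⟩ := h₂
  have hw : IsIntegral ℤ (aeval ((η ^ 2 + a₃ * η + (3 * b₂ : ℤ)) / 3) (X ^ 2 - C b₂ * X)) := by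
    have e : aeval ((η ^ 2 + a₃ * η + (3 * b₂ : ℤ)) / 3) (X ^ 2 - C b₂ * X) =
        ((-b₀ - b₁ * a₃ : ℤ) : K) + ((-b₁ : ℤ) : K) * η
          + a₃ * ((η ^ 3 + a₃ * η ^ 2 + (3 * b₂ : ℤ) * η + (9 * b₁ : ℤ)) / 9) := by
      simp only [map_sub, map_mul, map_pow, aeval_X, aeval_C, algebraMap_int_eq, Int.coe_castRingHom]
      push_cast at h ⊢
      linear_combination h / 9
    rw [e]
    exact ((isIntegral_intCast _).add ((isIntegral_intCast _).mul hη)).add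
      ((isIntegral_intCast _).mul hq)
  refine IsIntegral.of_aeval_monic (p := X ^ 2 - C b₂ * X) (by monicity!) ?_ hw
  have : (X ^ 2 - C b₂ * X : ℤ[X]).natDegree = 2 := by compute_degree!
  omega

end Integrality


/-! ### Saturation at 3 from two reductions to characteristic 3 -/

section Saturation

lemma three_dvd_of_map_eq_zero {R F : Type*} [CommRing R] [Field F] [CharP F 3] (φ : R →+* F)
    {n : ℤ} (h : φ n = 0) : (3 : ℤ) ∣ n := by
  rw [map_intCast] at h
  exact (CharP.intCast_eq_zero_iff F 3 n).1 h

variable {R : Type*} [CommRing R] [IsDomain R] [CharZero R] {F₁ F₂ : Type*} [Field F₁] [Field F₂]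
  [CharP F₁ 3] [CharP F₂ 3] {η : R} {b₀ b₁ b₂ a₃ s : ℤ}

/-- The case of a polygon with a side of slope `-1/3`. -/
lemma three_dvd_of_slope_one_third (φ : R →+* F₁) (ψ : R →+* F₂) (hφ : φ η = 0) (hψ : ψ η ≠ 0)
    (h : η ^ 4 + a₃ * η ^ 3 + 3 * b₂ * η ^ 2 + 3 * b₁ * η + 3 * b₀ = 0)
    (hb₀ : ¬ (3 : ℤ) ∣ b₀) {r₀ r₁ r₂ r₃ : ℤ} {z : R}
    (hz : 3 * z = r₀ + r₁ * (η + s) + r₂ * (η ^ 2 + a₃ * η + 3 * b₂)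
      + r₃ * (η ^ 3 + a₃ * η ^ 2 + 3 * b₂ * η + 3 * b₁)) :
    (3 : ℤ) ∣ r₀ ∧ (3 : ℤ) ∣ r₁ ∧ (3 : ℤ) ∣ r₂ ∧ (3 : ℤ) ∣ r₃ := by
  have h3 : (3 : R) ≠ 0 := by norm_num
  have hφ3 : φ 3 = 0 := by
    rw [map_ofNat]; exact_mod_cast CharP.cast_eq_zero F₁ 3
  have hψ3 : ψ 3 = 0 := by
    rw [map_ofNat]; exact_mod_cast CharP.cast_eq_zero F₂ 3
  have hp : Prime (3 : ℤ) := Int.prime_three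
  -- Where φ kills η, the powers 1, η, η² behave like elements of valuations 0, 1/3, 2/3, so their
  -- coefficients are peeled off in that order.
  obtain ⟨t₀, ht₀⟩ : (3 : ℤ) ∣ r₀ + s * r₁ := by
    apply three_dvd_of_map_eq_zero φ
    have := congrArg φ hz
    simp only [map_mul, map_add, map_pow, hφ, hφ3] at this
    push_cast
    simp only [map_mul, map_add]
    linear_combination -this
  have e₀ : (r₀ : R) = 3 * t₀ - s * r₁ := by
    have : (r₀ : R) + s * r₁ = 3 * t₀ := by exact_mod_cast congrArg (Int.cast (R := R)) ht₀
    linear_combination this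
  obtain ⟨t₁, ht₁⟩ : (3 : ℤ) ∣ r₁ + a₃ * r₂ := by
    refine (hp.dvd_or_dvd (?_ : (3 : ℤ) ∣ b₀ * (r₁ + a₃ * r₂))).resolve_left hb₀
    apply three_dvd_of_map_eq_zero φ
    -- The multiplier η²(a₃ + η) turns the term in η into η³(η + a₃) = -3(b₂η² + b₁η + b₀).
    -- Cancelling 3 leaves an identity whose image under φ isolates b₀ times the wanted coefficient.
    have e : (z - t₀ - r₂ * b₂ - r₃ * b₁ - r₃ * b₂ * η) * (η ^ 2 * (a₃ + η)) =
        -(b₂ * η ^ 2 + b₁ * η + b₀) * (r₁ + a₃ * r₂ + (r₂ + a₃ * r₃) * η + r₃ * η ^ 2) := by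
      refine mul_left_cancel₀ h3 ?_
      linear_combination η ^ 2 * (a₃ + η) * (hz + e₀)
        + (r₁ + a₃ * r₂ + (r₂ + a₃ * r₃) * η + r₃ * η ^ 2) * h
    have := congrArg φ e
    simp only [map_mul, map_add, map_sub, map_neg, map_pow, hφ] at this
    push_cast
    simp only [map_mul, map_add]
    linear_combination this
  have e₁ : (r₁ : R) = 3 * t₁ - a₃ * r₂ := by
    have : (r₁ : R) + a₃ * r₂ = 3 * t₁ := by exact_mod_cast congrArg (Int.cast (R := R)) ht₁
    linear_combination this
  obtain ⟨t₂, ht₂⟩ : (3 : ℤ) ∣ r₂ + a₃ * r₃ := by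
    refine (hp.dvd_or_dvd (?_ : (3 : ℤ) ∣ b₀ * (r₂ + a₃ * r₃))).resolve_left hb₀
    apply three_dvd_of_map_eq_zero φ
    have e : (z - t₀ - r₂ * b₂ - r₃ * b₁ - r₃ * b₂ * η - t₁ * η) * (η * (a₃ + η)) =
        -(b₂ * η ^ 2 + b₁ * η + b₀) * (r₂ + a₃ * r₃ + r₃ * η) := by
      refine mul_left_cancel₀ h3 ?_
      linear_combination η * (a₃ + η) * (hz + e₀ + η * e₁) + (r₂ + a₃ * r₃ + r₃ * η) * h
    have := congrArg φ e
    simp only [map_mul, map_add, map_sub, map_neg, map_pow, hφ] at this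
    push_cast
    simp only [map_mul, map_add]
    linear_combination this
  have e₂ : (r₂ : R) = 3 * t₂ - a₃ * r₃ := by
    have : (r₂ : R) + a₃ * r₃ = 3 * t₂ := by exact_mod_cast congrArg (Int.cast (R := R)) ht₂
    linear_combination this
  -- Only r₃η³ remains modulo 3, and φ gives nothing on it; ψ does, because ψ η ≠ 0.
  have d₃ : (3 : ℤ) ∣ r₃ := by
    apply three_dvd_of_map_eq_zero ψ
    have e : 3 * (z - t₀ - r₂ * b₂ - r₃ * b₁ - r₃ * b₂ * η - t₁ * η - t₂ * η ^ 2) =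
        r₃ * η ^ 3 := by
      linear_combination hz + e₀ + η * e₁ + η ^ 2 * e₂
    have := congrArg ψ e
    rw [map_mul, hψ3, zero_mul, map_mul, map_pow] at this
    exact (mul_eq_zero.1 this.symm).resolve_right (pow_ne_zero 3 hψ)
  have d₂ : (3 : ℤ) ∣ r₂ := (dvd_add_left (d₃.mul_left _)).1 ⟨t₂, ht₂⟩
  have d₁ : (3 : ℤ) ∣ r₁ := (dvd_add_left (d₂.mul_left _)).1 ⟨t₁, ht₁⟩
  exact ⟨(dvd_add_left (d₁.mul_left _)).1 ⟨t₀, ht₀⟩, d₁, d₂, d₃⟩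

/-- The case of a polygon with a side of slope `-2/3`. -/
lemma three_dvd_of_slope_two_thirds (φ : R →+* F₁) (ψ : R →+* F₂) (hφ : φ η = 0) (hψ : ψ η ≠ 0)
    (h : η ^ 4 + a₃ * η ^ 3 + 3 * b₂ * η ^ 2 + 9 * b₁ * η + 9 * b₀ = 0)
    (hb₀ : ¬ (3 : ℤ) ∣ b₀) (ha₃ : ¬ (3 : ℤ) ∣ a₃) {ρ : R}
    (hρ : 3 * ρ = η ^ 3 + a₃ * η ^ 2 + 3 * b₂ * η + 9 * b₁)
    {r₀ r₁ r₂ r₃ : ℤ} {z : R}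
    (hz : 3 * z = r₀ + r₁ * (η + s) + r₂ * (η ^ 2 + a₃ * η + 3 * b₂) + r₃ * ρ) :
    (3 : ℤ) ∣ r₀ ∧ (3 : ℤ) ∣ r₁ ∧ (3 : ℤ) ∣ r₂ ∧ (3 : ℤ) ∣ r₃ := by
  have h3 : (3 : R) ≠ 0 := by norm_num
  have hφ3 : φ 3 = 0 := by
    rw [map_ofNat]; exact_mod_cast CharP.cast_eq_zero F₁ 3
  have hψ3 : ψ 3 = 0 := by
    rw [map_ofNat]; exact_mod_cast CharP.cast_eq_zero F₂ 3
  have hp : Prime (3 : ℤ) := Int.prime_three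
  have hη : η ≠ 0 := fun h0 => hψ (by rw [h0, map_zero])
  have hηρ : η * ρ = -(3 * b₀) := by
    refine mul_left_cancel₀ h3 ?_
    linear_combination η * hρ + h
  -- The reversed equation makes ρ⁴ a multiple of 3. Locally at φ, ρ behaves like valuation 1/3 and
  -- η like 2/3, so the order of elimination is 1, ρ, η.
  have hφρ : φ ρ = 0 := by
    have e : ρ ^ 4 - 3 * b₁ * ρ ^ 3 + 3 * b₂ * b₀ * ρ ^ 2 - 3 * a₃ * b₀ ^ 2 * ρ
        + 9 * b₀ ^ 3 = 0 := by
      refine (mul_eq_zero.1 (?_ : η ^ 4 * _ = 0)).resolve_left (pow_ne_zero 4 hη)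
      have e4 : (η * ρ) ^ 4 = (-(3 * b₀) : R) ^ 4 := by rw [hηρ]
      have e3 : (η * ρ) ^ 3 = (-(3 * b₀) : R) ^ 3 := by rw [hηρ]
      have e2 : (η * ρ) ^ 2 = (-(3 * b₀) : R) ^ 2 := by rw [hηρ]
      linear_combination e4 - 3 * b₁ * η * e3 + 3 * b₂ * b₀ * η ^ 2 * e2
        - 3 * a₃ * b₀ ^ 2 * η ^ 3 * hηρ + 9 * b₀ ^ 3 * h
    have := congrArg φ e
    have h9 : φ 9 = 0 := by
      rw [show (9 : R) = 3 * 3 by norm_num, map_mul, hφ3, zero_mul]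
    simp only [map_mul, map_add, map_sub, map_pow, hφ3, h9, map_zero, zero_mul, sub_zero,
      add_zero] at this
    exact pow_eq_zero_iff (by norm_num) |>.1 this
  have hsq : η ^ 2 * (η + a₃) = 3 * (ρ - b₂ * η - 3 * b₁) := by
    linear_combination -hρ
  obtain ⟨t₀, ht₀⟩ : (3 : ℤ) ∣ r₀ + s * r₁ := by
    apply three_dvd_of_map_eq_zero φ
    have := congrArg φ hz
    simp only [map_mul, map_add, map_pow, hφ, hφ3, hφρ] at this
    push_cast
    simp only [map_mul, map_add]
    linear_combination -this
  have e₀ : (r₀ : R) = 3 * t₀ - s * r₁ := by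
    have : (r₀ : R) + s * r₁ = 3 * t₀ := by exact_mod_cast congrArg (Int.cast (R := R)) ht₀
    linear_combination this
  have d₃ : (3 : ℤ) ∣ r₃ := by
    refine (hp.dvd_or_dvd (?_ : (3 : ℤ) ∣ (b₀ * a₃) * r₃)).resolve_left
      (fun hd => (hp.dvd_or_dvd hd).elim hb₀ ha₃)
    apply three_dvd_of_map_eq_zero φ
    have e : (z - t₀ - r₂ * b₂) * η * (η + a₃) =
        (r₁ + a₃ * r₂ + r₂ * η) * (ρ - b₂ * η - 3 * b₁) - r₃ * b₀ * (η + a₃) := by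
      refine mul_left_cancel₀ h3 ?_
      linear_combination η * (η + a₃) * (hz + e₀) + (r₁ + a₃ * r₂ + r₂ * η) * hsq
        + r₃ * (η + a₃) * hηρ
    have := congrArg φ e
    simp only [map_mul, map_add, map_sub, hφ, hφρ, hφ3] at this
    push_cast
    simp only [map_mul]
    linear_combination this
  obtain ⟨t₃, ht₃⟩ := d₃
  have e₃ : (r₃ : R) = 3 * t₃ := by exact_mod_cast congrArg (Int.cast (R := R)) ht₃
  obtain ⟨t₁, ht₁⟩ : (3 : ℤ) ∣ r₁ + a₃ * r₂ := by
    refine (hp.dvd_or_dvd (?_ : (3 : ℤ) ∣ b₀ * (r₁ + a₃ * r₂))).resolve_left hb₀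
    apply three_dvd_of_map_eq_zero φ
    have e : (z - t₀ - r₂ * b₂ - t₃ * ρ) * ρ = -(r₁ + a₃ * r₂ + r₂ * η) * b₀ := by
      refine mul_left_cancel₀ h3 ?_
      linear_combination ρ * (hz + e₀ + ρ * e₃) + (r₁ + a₃ * r₂ + r₂ * η) * hηρ
    have := congrArg φ e
    simp only [map_mul, map_add, map_sub, map_neg, hφ, hφρ] at this
    push_cast
    simp only [map_mul, map_add]
    linear_combination this
  have e₁ : (r₁ : R) = 3 * t₁ - a₃ * r₂ := by
    have : (r₁ : R) + a₃ * r₂ = 3 * t₁ := by exact_mod_cast congrArg (Int.cast (R := R)) ht₁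
    linear_combination this
  have d₂ : (3 : ℤ) ∣ r₂ := by
    apply three_dvd_of_map_eq_zero ψ
    have e : 3 * (z - t₀ - r₂ * b₂ - t₃ * ρ - t₁ * η) = r₂ * η ^ 2 := by
      linear_combination hz + e₀ + ρ * e₃ + η * e₁
    have := congrArg ψ e
    rw [map_mul, hψ3, zero_mul, map_mul, map_pow] at this
    exact (mul_eq_zero.1 this.symm).resolve_right (pow_ne_zero 2 hψ)
  have d₁ : (3 : ℤ) ∣ r₁ := (dvd_add_left (d₂.mul_left _)).1 ⟨t₁, ht₁⟩
  exact ⟨(dvd_add_left (d₁.mul_left _)).1 ⟨t₀, ht₀⟩, d₁, d₂, ⟨t₃, ht₃⟩⟩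

end Saturation

/-! ### Reductions of the ring of integers at roots of f modulo p -/

section QuarticBasis

open NumberField

universe u

variable {K : Type u} [Field K] [NumberField K] {a b c : ℤ} {θ : K}

/-- A root `t` of `f` modulo `p` yields a homomorphism from the ring of integers to a field of
characteristic `p` that sends `θ` to `t`. -/
lemma exists_ringHom_of_dvd_eval {p : ℕ} [Fact p.Prime] (hf : Irreducible (quartic a b c))
    {ϑ : 𝓞 K} (hϑ : aeval ϑ (quartic a b c) = 0) {t : ℤ}
    (ht : (p : ℤ) ∣ (quartic a b c).eval t) :
    ∃ (F : Type u) (_ : Field F) (_ : CharP F p) (φ : 𝓞 K →+* F), φ ϑ = t := by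
  let ev : ℤ[X] →+* ZMod p := (Int.castRingHom (ZMod p)).comp (evalRingHom t)
  let P : Ideal ℤ[X] := RingHom.ker ev
  have hP : P.IsPrime := RingHom.ker_isPrime ev
  -- Through X ↦ ϑ the ring of integers is integral over ℤ[X], with kernel (f) ⊆ P, so lying over
  -- gives a prime Q above the kernel P of evaluation at t modulo p.
  let _ : Algebra ℤ[X] (𝓞 K) := (aeval ϑ : ℤ[X] →ₐ[ℤ] 𝓞 K).toRingHom.toAlgebra
  have hC : ∀ g : ℤ[X], algebraMap ℤ[X] (𝓞 K) g = aeval ϑ g := fun _ => rfl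
  have : IsScalarTower ℤ ℤ[X] (𝓞 K) := IsScalarTower.of_algebraMap_eq fun n => by
    rw [hC]; simp
  have : Algebra.IsIntegral ℤ[X] (𝓞 K) :=
    ⟨fun x => (Algebra.IsIntegral.isIntegral (R := ℤ) x).tower_top⟩
  have hker : Ideal.comap (algebraMap ℤ[X] (𝓞 K)) ⊥ ≤ P := by
    intro g hg
    rw [Ideal.mem_comap, hC, Ideal.mem_bot] at hg
    have hm : minpoly ℤ ϑ = quartic a b c := by
      have hint : IsIntegral ℤ ϑ := Algebra.IsIntegral.isIntegral _
      have hdvd := minpoly.isIntegrallyClosed_dvd hint hϑ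
      refine eq_of_monic_of_associated (minpoly.monic hint) (quartic_monic a b c) ?_
      exact (hf.dvd_iff.1 hdvd).resolve_left (minpoly.not_isUnit ℤ ϑ) |>.symm
    obtain ⟨q, rfl⟩ := minpoly.isIntegrallyClosed_dvd (Algebra.IsIntegral.isIntegral ϑ) hg
    rw [hm]
    refine Ideal.mul_mem_right _ _ ?_
    rw [RingHom.mem_ker]
    exact (ZMod.intCast_zmod_eq_zero_iff_dvd _ p).2 ht
  obtain ⟨Q, -, hQ, hQP⟩ := Ideal.exists_ideal_over_prime_of_isIntegral P ⊥ hker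
  have hmem : ∀ g : ℤ[X], aeval ϑ g ∈ Q ↔ ev g = 0 := by
    intro g
    rw [← hC, ← Ideal.mem_comap, hQP, RingHom.mem_ker]
  let ι := algebraMap (𝓞 K ⧸ Q) (FractionRing (𝓞 K ⧸ Q))
  refine ⟨FractionRing (𝓞 K ⧸ Q), inferInstance, ?_, ι.comp (Ideal.Quotient.mk Q), ?_⟩
  · have h0 : ((p : 𝓞 K ⧸ Q)) = 0 := by
      have := (hmem (C (p : ℤ))).2 (by simp [ev])
      rw [← map_natCast (Ideal.Quotient.mk Q), Ideal.Quotient.eq_zero_iff_mem]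
      simpa using this
    have hp0 : ((p : FractionRing (𝓞 K ⧸ Q))) = 0 := by
      rw [← map_natCast ι, h0, map_zero]
    exact ringChar.of_eq (CharP.ringChar_of_prime_eq_zero Fact.out hp0)
  · have := (hmem (X - C t)).2 (by simp [ev])
    rw [map_sub, aeval_X, aeval_C, ← Ideal.Quotient.eq_zero_iff_mem, map_sub, sub_eq_zero] at this
    rw [RingHom.comp_apply, this]
    simp

end QuarticBasis

/-! ### Valuations of the development and of the discriminant -/

section Arithmetic

variable {a b c s : ℤ}

lemma val_eq_iff {n : ℤ} {k : ℕ} : val 3 n = k ↔ 3 ^ k ∣ n ∧ ¬ 3 ^ (k + 1) ∣ n := by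
  simp only [val, Nat.cast_ofNat]
  exact emultiplicity_eq_coe

lemma lt_val_iff {n : ℤ} {k : ℕ} : (k : ℕ∞) < val 3 n ↔ 3 ^ (k + 1) ∣ n := by
  rw [← Order.add_one_le_iff_of_not_isMax (by simp), val]
  have := pow_dvd_iff_le_emultiplicity (a := (3 : ℤ)) (b := n) (k := k + 1)
  push_cast at this ⊢
  exact this.symm

lemma padicValInt_three_pow_mul {k : ℕ} {m : ℤ} (hm : ¬ (3 : ℤ) ∣ m) :
    padicValInt 3 (3 ^ k * m) = k := by
  have h3 : Fact (Nat.Prime 3) := ⟨Nat.prime_three⟩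
  have hm0 : m ≠ 0 := by rintro rfl; exact hm (dvd_zero _)
  rw [padicValInt.mul (by positivity) hm0, padicValInt.eq_zero_of_not_dvd hm, add_zero]
  have : ((3 : ℤ) ^ k) = ((3 ^ k : ℕ) : ℤ) := by push_cast; rfl
  rw [this, padicValInt.of_nat, padicValNat.prime_pow]

lemma not_three_dvd_of_modEq_neg (hb : ¬ (3 : ℤ) ∣ b) (hs : s ≡ -b [ZMOD 3]) :
    ¬ (3 : ℤ) ∣ s := by
  intro h
  unfold Int.ModEq at hs
  omega

lemma three_dvd_sq_sub_one (hs : ¬ (3 : ℤ) ∣ s) : (3 : ℤ) ∣ s ^ 2 - 1 := by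
  have h : s % 3 = 1 ∨ s % 3 = 2 := by omega
  have e : s = 3 * (s / 3) + s % 3 := (Int.mul_ediv_add_emod s 3).symm
  rcases h with h | h <;> rw [h] at e
  · exact ⟨3 * (s / 3) ^ 2 + 2 * (s / 3), by linear_combination (s + 3 * (s / 3) + 1) * e⟩
  · exact ⟨3 * (s / 3) ^ 2 + 4 * (s / 3) + 1, by linear_combination (s + 3 * (s / 3) + 2) * e⟩

/-- Since s² ≡ 1 mod 3, 6s² + a ≡ 6 + a mod 9, which is 6 or 3. This is where a ≢ 3 mod 9 enters. -/
lemma exists_devCoeff_two (ha : a ≡ 0 [ZMOD 9] ∨ a ≡ 6 [ZMOD 9]) (hs : ¬ (3 : ℤ) ∣ s) :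
    ∃ w, 6 * s ^ 2 + a = 3 * w ∧ ¬ (3 : ℤ) ∣ w := by
  obtain ⟨k, hk⟩ := three_dvd_sq_sub_one hs
  have hs2 : s ^ 2 = 3 * k + 1 := by linarith
  rw [hs2]
  unfold Int.ModEq at ha
  refine ⟨(6 * (3 * k + 1) + a) / 3, ?_, ?_⟩ <;> omega

/-- Modulo 3, f is x⁴ + bx = x(x + b)³, with a multiple root at -b. -/
lemma three_dvd_eval (ha : (3 : ℤ) ∣ a) (hc : (3 : ℤ) ∣ c) (hb : ¬ (3 : ℤ) ∣ b)
    (hs : s ≡ -b [ZMOD 3]) :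
    (3 : ℤ) ∣ (quartic a b c).eval s ∧ (3 : ℤ) ∣ (derivative (quartic a b c)).eval s := by
  obtain ⟨k, hk⟩ := three_dvd_sq_sub_one (not_three_dvd_of_modEq_neg hb hs)
  obtain ⟨t, ht⟩ := hs.symm.dvd
  obtain ⟨a, rfl⟩ := ha
  obtain ⟨c, rfl⟩ := hc
  have hb' : b = 3 * t - s := by linarith
  rw [eval_quartic, eval_derivative_quartic]
  refine ⟨⟨s ^ 2 * k + a * s ^ 2 + t * s + c, by rw [hb']; linear_combination s ^ 2 * hk⟩,
    ⟨s ^ 3 + s * k + 2 * a * s + t, by rw [hb']; linear_combination s * hk⟩⟩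

/-- The discriminant of `f` in terms of the coefficients of its development. -/
lemma discr_quartic_eq_devCoeff (a b c s : ℤ) {a₀ a₁ a₂ a₃ : ℤ}
    (h₀ : s ^ 4 + a * s ^ 2 + b * s + c = a₀) (h₁ : 4 * s ^ 3 + 2 * a * s + b = a₁)
    (h₂ : 6 * s ^ 2 + a = a₂) (h₃ : 4 * s = a₃) :
    (quartic a b c).discr = 256 * a₀ ^ 3 - 192 * a₃ * a₁ * a₀ ^ 2 - 128 * a₂ ^ 2 * a₀ ^ 2
      + 144 * a₂ * a₁ ^ 2 * a₀ - 27 * a₁ ^ 4 + 144 * a₃ ^ 2 * a₂ * a₀ ^ 2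
      - 6 * a₃ ^ 2 * a₁ ^ 2 * a₀ - 80 * a₃ * a₂ ^ 2 * a₁ * a₀ + 18 * a₃ * a₂ * a₁ ^ 3
      + 16 * a₂ ^ 4 * a₀ - 4 * a₂ ^ 3 * a₁ ^ 2 - 27 * a₃ ^ 4 * a₀ ^ 2
      + 18 * a₃ ^ 3 * a₂ * a₁ * a₀ - 4 * a₃ ^ 3 * a₁ ^ 3 - 4 * a₃ ^ 2 * a₂ ^ 3 * a₀
      + a₃ ^ 2 * a₂ ^ 2 * a₁ ^ 2 := by
  rw [discr_quartic]
  subst h₀ h₁ h₂ h₃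
  ring

/-- The term -4a₃³a₁³ has valuation exactly 3, and every other term has a larger one. -/
lemma exists_discr_of_val_derivative_eq_one {u v w : ℤ} (hs : ¬ (3 : ℤ) ∣ s)
    (h₀ : s ^ 4 + a * s ^ 2 + b * s + c = 9 * v) (h₁ : 4 * s ^ 3 + 2 * a * s + b = 3 * u)
    (h₂ : 6 * s ^ 2 + a = 3 * w) (hu : ¬ (3 : ℤ) ∣ u) :
    ∃ D, (quartic a b c).discr = 3 ^ 3 * D ∧ ¬ (3 : ℤ) ∣ D := by
  have hE : (quartic a b c).discr = 3 ^ 3 * (3 * (256 * 9 * v ^ 3 - 192 * 3 * (4 * s) * u * v ^ 2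
      - 128 * 9 * w ^ 2 * v ^ 2 + 144 * 3 * w * u ^ 2 * v - 27 * u ^ 4
      + 144 * 3 * (4 * s) ^ 2 * w * v ^ 2 - 6 * (4 * s) ^ 2 * u ^ 2 * v
      - 80 * 3 * (4 * s) * w ^ 2 * u * v + 18 * (4 * s) * w * u ^ 3 + 16 * 9 * w ^ 4 * v
      - 12 * w ^ 3 * u ^ 2 - 27 * (4 * s) ^ 4 * v ^ 2 + 18 * (4 * s) ^ 3 * w * u * v
      - 12 * (4 * s) ^ 2 * w ^ 3 * v + (4 * s) ^ 2 * w ^ 2 * u ^ 2) - 4 ^ 4 * (s * u) ^ 3) := by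
    rw [discr_quartic_eq_devCoeff a b c s h₀ h₁ h₂ rfl]
    ring
  refine ⟨_, hE, fun hd => ?_⟩
  have : (3 : ℤ) ∣ 4 ^ 4 * (s * u) ^ 3 := (dvd_sub_right (dvd_mul_right 3 _)).1 hd
  rcases Int.prime_three.dvd_or_dvd this with h | h
  · omega
  · exact (Int.prime_three.dvd_or_dvd (Int.prime_three.dvd_of_dvd_pow h)).elim hs hu

/-- The term -4a₃²a₂³a₀ has valuation exactly k + 6. The bound on m gives 3^(k+7) ∣ a₁², which makes
the terms in a₁² negligible. -/
lemma exists_discr_of_lt_two_mul {k m : ℕ} {e u w : ℤ} (hs : ¬ (3 : ℤ) ∣ s)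
    (h₀ : s ^ 4 + a * s ^ 2 + b * s + c = 3 ^ (k + 3) * e)
    (h₁ : 4 * s ^ 3 + 2 * a * s + b = 3 ^ m * u)
    (h₂ : 6 * s ^ 2 + a = 3 * w) (he : ¬ (3 : ℤ) ∣ e) (hw : ¬ (3 : ℤ) ∣ w) (hm : k + 6 < 2 * m) :
    ∃ D, (quartic a b c).discr = 3 ^ (k + 6) * D ∧ ¬ (3 : ℤ) ∣ D := by
  obtain ⟨h, hh⟩ : ∃ h, 3 ^ m * u = 9 * h := by
    refine ⟨3 ^ (m - 2) * u, ?_⟩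
    rw [← mul_assoc, show (9 : ℤ) = 3 ^ 2 by norm_num, ← pow_add, show 2 + (m - 2) = m by omega]
  obtain ⟨g, hg⟩ : ∃ g, (9 * h) ^ 2 = 81 * (27 * 3 ^ k) * g := by
    refine ⟨3 ^ (2 * m - (k + 7)) * u ^ 2, ?_⟩
    rw [← hh, mul_pow, ← pow_mul, mul_comm m 2]
    nth_rw 1 [show 2 * m = (k + 7) + (2 * m - (k + 7)) by omega]
    ring
  have h₀' : s ^ 4 + a * s ^ 2 + b * s + c = 27 * 3 ^ k * e := by rw [h₀]; ring
  generalize hM : (3 : ℤ) ^ k = M at h₀' hg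
  have hE : (quartic a b c).discr = 3 ^ (k + 6) * (3 * (256 * 9 * M ^ 2 * e ^ 3
      - 192 * 3 * (4 * s) * M * e ^ 2 * h - 128 * 3 * w ^ 2 * M * e ^ 2 + 144 * 3 * w * h ^ 2 * e
      - 27 * 81 * g * h ^ 2 + 144 * (4 * s) ^ 2 * w * M * e ^ 2 - 6 * (4 * s) ^ 2 * h ^ 2 * e
      - 80 * (4 * s) * w ^ 2 * h * e + 18 * 27 * (4 * s) * w * h * g + 16 * w ^ 4 * e
      - 4 * 27 * w ^ 3 * g - 9 * (4 * s) ^ 4 * M * e ^ 2 + 6 * (4 * s) ^ 3 * w * h * e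
      - 36 * (4 * s) ^ 3 * g * h + 9 * (4 * s) ^ 2 * w ^ 2 * g) - 4 ^ 3 * (s ^ 2 * w ^ 3 * e)) := by
    rw [discr_quartic_eq_devCoeff a b c s h₀' (h₁.trans hh) h₂ rfl, pow_add, hM]
    linear_combination (-27 * (9 * h) ^ 2 + 18 * (4 * s) * (3 * w) * (9 * h) - 4 * (3 * w) ^ 3
      - 4 * (4 * s) ^ 3 * (9 * h) + (4 * s) ^ 2 * (3 * w) ^ 2) * hg
  refine ⟨_, hE, fun hd => ?_⟩
  have : (3 : ℤ) ∣ 4 ^ 3 * (s ^ 2 * w ^ 3 * e) := (dvd_sub_right (dvd_mul_right 3 _)).1 hd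
  have hp := Int.prime_three
  rcases hp.dvd_or_dvd this with h | h
  · omega
  · rcases hp.dvd_or_dvd h with h | h
    · exact (hp.dvd_or_dvd h).elim (fun h => hs (hp.dvd_of_dvd_pow h))
        (fun h => hw (hp.dvd_of_dvd_pow h))
    · exact he h

/-- Given 9 ∣ a₁ and 3 ∣ a₂, each term of the discriminant is a multiple of a₁² or of 27a₀, and both
are divisible by 3^(2m). -/
lemma pow_dvd_discr {k m : ℕ} {e u w : ℤ}
    (h₀ : s ^ 4 + a * s ^ 2 + b * s + c = 3 ^ (k + 3) * e)
    (h₁ : 4 * s ^ 3 + 2 * a * s + b = 3 ^ m * u) (hm2 : 2 ≤ m)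
    (h₂ : 6 * s ^ 2 + a = 3 * w) (hm : 2 * m ≤ k + 6) :
    3 ^ (2 * m) ∣ (quartic a b c).discr := by
  obtain ⟨h, hh⟩ : ∃ h, 3 ^ m * u = 9 * h := by
    refine ⟨3 ^ (m - 2) * u, ?_⟩
    rw [← mul_assoc, show (9 : ℤ) = 3 ^ 2 by norm_num, ← pow_add, show 2 + (m - 2) = m by omega]
  have hsq : (3 : ℤ) ^ (2 * m) ∣ (9 * h) ^ 2 := by
    rw [← hh, mul_pow, ← pow_mul, mul_comm m 2]
    exact dvd_mul_right _ _
  have hn : (3 : ℤ) ^ (2 * m) ∣ 27 * (27 * 3 ^ k * e) := by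
    have : 27 * (27 * 3 ^ k * e) = 3 ^ (k + 6) * e := by ring
    rw [this]
    exact Dvd.dvd.mul_right (pow_dvd_pow _ hm) _
  have h₀' : s ^ 4 + a * s ^ 2 + b * s + c = 27 * 3 ^ k * e := by rw [h₀]; ring
  generalize (3 : ℤ) ^ k = M at h₀' hn
  have hE : (quartic a b c).discr = 27 * (27 * M * e) * (256 * 27 * M ^ 2 * e ^ 2
      - 192 * 9 * (4 * s) * M * e * h - 128 * 9 * w ^ 2 * M * e
      + 144 * 3 * (4 * s) ^ 2 * w * M * e - 80 * 3 * (4 * s) * w ^ 2 * h + 16 * 3 * w ^ 4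
      - 27 * (4 * s) ^ 4 * M * e + 18 * (4 * s) ^ 3 * w * h - 4 * (4 * s) ^ 2 * w ^ 3)
      + (9 * h) ^ 2 * (144 * (3 * w) * (27 * M * e) - 27 * (9 * h) ^ 2
        - 6 * (4 * s) ^ 2 * (27 * M * e) + 18 * (4 * s) * (3 * w) * (9 * h) - 4 * (3 * w) ^ 3
        - 4 * (4 * s) ^ 3 * (9 * h) + (4 * s) ^ 2 * (3 * w) ^ 2) := by
    rw [discr_quartic_eq_devCoeff a b c s h₀' (h₁.trans hh) h₂ rfl]
    ring
  rw [hE]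
  exact dvd_add (hn.mul_right _) (hsq.mul_right _)

/-- Hensel lifting of the root `-b` of `f'` modulo `9`. -/
lemma exists_pow_dvd_derivative (ha : a ≡ 0 [ZMOD 9] ∨ a ≡ 6 [ZMOD 9]) (hb : ¬ (3 : ℤ) ∣ b)
    (h : 9 ∣ (derivative (quartic a b c)).eval (-b)) (k : ℕ) :
    ∃ s, s ≡ -b [ZMOD 3] ∧ 3 ^ (k + 2) ∣ (derivative (quartic a b c)).eval s := by
  induction k with
  | zero => exact ⟨-b, rfl, by simpa using h⟩
  | succ k ih =>
    obtain ⟨s, hs, u, hu⟩ := ih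
    have hs3 := not_three_dvd_of_modEq_neg hb hs
    obtain ⟨w, hw, hw3⟩ := exists_devCoeff_two ha hs3
    obtain ⟨q, hq⟩ := three_dvd_sq_sub_one hw3
    -- Newton step. As f''(s)/2 = 3w, the linear part of f' at the new point is 3^(k+2) u (1 + 2w²),
    -- and w² ≡ 1 mod 3 gains one power of 3. The derivative f'' has valuation 1, so the correction
    -- is 3^(k+1), not 3^(k+2).
    refine ⟨s + 3 ^ (k + 1) * (u * w), ?_, u + 2 * u * q + 4 * s * 3 ^ k * (u * w) ^ 2
      + 4 * 3 ^ (2 * k) * (u * w) ^ 3, ?_⟩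
    · refine Int.ModEq.trans ?_ hs
      refine (Int.modEq_iff_dvd.2 ⟨3 ^ k * (u * w), ?_⟩).symm
      ring
    · rw [eval_derivative_quartic] at hu ⊢
      linear_combination hu + 2 * 3 ^ (k + 1) * (u * w) * hw + 2 * 3 ^ (k + 2) * u * hq
end Arithmetic

/-! ### The family is a 3-integral basis, shape by shape -/

section TripleFamily

open NumberField

universe v

variable {K : Type v} [Field K] {a b c s : ℤ} {θ : K}

lemma aeval_quartic_eq_devCoeff (hθ : aeval θ (quartic a b c) = 0) {a₀ a₁ a₂ : ℤ}
    (h₀ : s ^ 4 + a * s ^ 2 + b * s + c = a₀) (h₁ : 4 * s ^ 3 + 2 * a * s + b = a₁)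
    (h₂ : 6 * s ^ 2 + a = a₂) :
    (θ - s) ^ 4 + (4 * s : ℤ) * (θ - s) ^ 3 + a₂ * (θ - s) ^ 2 + a₁ * (θ - s) + a₀ = 0 := by
  rw [aeval_quartic] at hθ
  subst h₀ h₁ h₂
  push_cast
  linear_combination hθ

/-- The numerators are the Horner quotients of f rewritten in η = θ - s. -/
lemma tripleFamily_eq_devCoeff {a₁ a₂ : ℤ} (h₁ : 4 * s ^ 3 + 2 * a * s + b = a₁)
    (h₂ : 6 * s ^ 2 + a = a₂) (ν₁ ν₂ : ℕ) :
    tripleFamily 3 a b s θ ν₁ ν₂ = ![1, θ,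
      ((θ - s) ^ 2 + (4 * s : ℤ) * (θ - s) + a₂) / 3 ^ ν₂,
      ((θ - s) ^ 3 + (4 * s : ℤ) * (θ - s) ^ 2 + a₂ * (θ - s) + a₁) / 3 ^ ν₁] := by
  have e₂ : θ ^ 2 + 2 * (s : K) * θ + 3 * (s : K) ^ 2 + a =
      (θ - s) ^ 2 + (4 * s : ℤ) * (θ - s) + a₂ := by
    rw [← h₂]; push_cast; ring
  have e₁ : θ ^ 3 + (s : K) * θ ^ 2 + ((s : K) ^ 2 + a) * θ + (s : K) ^ 3 + a * s + b =
      (θ - s) ^ 3 + (4 * s : ℤ) * (θ - s) ^ 2 + a₂ * (θ - s) + a₁ := by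
    rw [← h₂, ← h₁]; push_cast; ring
  rw [tripleFamily, e₁, e₂, zpow_natCast, zpow_natCast, Nat.cast_ofNat]

variable [NumberField K]

/-- The transition matrix from the power basis is triangular with determinant 3^(-(ν₁+ν₂)). -/
lemma discr_tripleFamily (hf : Irreducible (quartic a b c))
    (hθ : aeval θ (quartic a b c) = 0) (hK : IntermediateField.adjoin ℚ {θ} = ⊤) (ν₁ ν₂ : ℕ) :
    (3 : ℚ) ^ (2 * (ν₁ + ν₂)) * Algebra.discr ℚ (tripleFamily 3 a b s θ ν₁ ν₂) =
      (quartic a b c).discr := by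
  obtain ⟨B, hB⟩ := exists_basis_pow hf hθ hK
  let M : Matrix (Fin 4) (Fin 4) ℚ :=
    !![1, 0, (3 * s ^ 2 + a) / 3 ^ ν₂, (s ^ 3 + a * s + b) / 3 ^ ν₁;
       0, 1, 2 * s / 3 ^ ν₂, (s ^ 2 + a) / 3 ^ ν₁;
       0, 0, 1 / 3 ^ ν₂, s / 3 ^ ν₁;
       0, 0, 0, 1 / 3 ^ ν₁]
  have hM : M.det = 1 / 3 ^ (ν₁ + ν₂) := by
    simp [M, Matrix.det_succ_row_zero, Fin.succAbove, Fin.sum_univ_succ, pow_add]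
  have hfam : tripleFamily 3 a b s θ ν₁ ν₂ = Matrix.vecMul B (M.map (algebraMap ℚ K)) := by
    ext i
    fin_cases i <;>
      simp [tripleFamily, Matrix.vecMul, dotProduct, Fin.sum_univ_four, hB, M] <;> ring
  rw [hfam, Algebra.discr_of_matrix_vecMul, hM, algebra_discr_pow hB hθ]
  field_simp
  ring

lemma discr_quartic_ne_zero (hf : Irreducible (quartic a b c))
    (hθ : aeval θ (quartic a b c) = 0) (hK : IntermediateField.adjoin ℚ {θ} = ⊤) :
    (quartic a b c).discr ≠ 0 := by
  obtain ⟨B, hB⟩ := exists_basis_pow hf hθ hK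
  have h := Algebra.discr_not_zero_of_basis ℚ B
  rw [algebra_discr_pow hB hθ] at h
  exact_mod_cast h

lemma card_fin_four_eq_finrank (hf : Irreducible (quartic a b c))
    (hθ : aeval θ (quartic a b c) = 0) (hK : IntermediateField.adjoin ℚ {θ} = ⊤) :
    Fintype.card (Fin 4) = Module.finrank ℚ K := by
  obtain ⟨B, hB⟩ := exists_basis_pow hf hθ hK
  exact (Module.finrank_eq_card_basis B).symm

lemma linearIndependent_tripleFamily (hf : Irreducible (quartic a b c))
    (hθ : aeval θ (quartic a b c) = 0) (hK : IntermediateField.adjoin ℚ {θ} = ⊤) (ν₁ ν₂ : ℕ) :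
    LinearIndependent ℚ (tripleFamily 3 a b s θ ν₁ ν₂) := by
  by_contra h
  have h0 := discr_tripleFamily (s := s) hf hθ hK ν₁ ν₂
  rw [Algebra.discr_zero_of_not_linearIndependent ℚ h, mul_zero] at h0
  exact discr_quartic_ne_zero hf hθ hK (by exact_mod_cast h0.symm)

lemma isPIntegralBasis_of_discr_quartic (hf : Irreducible (quartic a b c))
    (hθ : aeval θ (quartic a b c) = 0) (hK : IntermediateField.adjoin ℚ {θ} = ⊤) {ν₁ ν₂ : ℕ}
    {D : ℤ} (hD : (quartic a b c).discr = 3 ^ (2 * (ν₁ + ν₂)) * D) (hD9 : ¬ (3 : ℤ) ^ 2 ∣ D)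
    (hint : ∀ i, IsIntegral ℤ (tripleFamily 3 a b s θ ν₁ ν₂ i)) :
    IsPIntegralBasis 3 (tripleFamily 3 a b s θ ν₁ ν₂) := by
  refine isPIntegralBasis_of_discr hint (card_fin_four_eq_finrank hf hθ hK) (D := D) ?_
    (by exact_mod_cast hD9)
  have h := discr_tripleFamily (s := s) hf hθ hK ν₁ ν₂
  rw [hD] at h
  push_cast at h
  exact mul_left_cancel₀ (by positivity) h

lemma isPIntegralBasis_of_val_derivative_eq_one (hf : Irreducible (quartic a b c))
    (hθ : aeval θ (quartic a b c) = 0) (hK : IntermediateField.adjoin ℚ {θ} = ⊤) {u v w : ℤ}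
    (hs : ¬ (3 : ℤ) ∣ s) (hs0 : s ^ 4 + a * s ^ 2 + b * s + c ≠ 0)
    (h₀ : s ^ 4 + a * s ^ 2 + b * s + c = 9 * v) (h₁ : 4 * s ^ 3 + 2 * a * s + b = 3 * u)
    (h₂ : 6 * s ^ 2 + a = 3 * w) (hu : ¬ (3 : ℤ) ∣ u) :
    IsPIntegralBasis 3 (tripleFamily 3 a b s θ (1 : ℕ) (0 : ℕ)) := by
  obtain ⟨D, hD, hD3⟩ := exists_discr_of_val_derivative_eq_one hs h₀ h₁ h₂ hu
  refine isPIntegralBasis_of_discr_quartic hf hθ hK (D := 3 * D) (by rw [hD]; ring) (by omega) ?_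
  have hrel := aeval_quartic_eq_devCoeff hθ h₀ h₁ h₂
  have hθi := isIntegral_of_aeval_quartic hθ
  have hηi : IsIntegral ℤ (θ - s) := hθi.sub (isIntegral_intCast _)
  have h1 := isIntegral_cubic_quotient_div (ν := 1) hrel (h₀ ▸ hs0) ⟨u, by ring⟩
    ⟨3 * w * v, by ring⟩ ⟨12 * s * v ^ 2, by ring⟩ ⟨9 * v ^ 3, by ring⟩
  rw [tripleFamily_eq_devCoeff h₁ h₂]
  intro i
  fin_cases i
  · exact isIntegral_one
  · exact hθi
  · simpa using ((hηi.pow 2).add ((isIntegral_intCast (4 * s)).mul hηi)).add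
      (isIntegral_intCast (3 * w))
  · exact h1

lemma isPIntegralBasis_of_lt_two_mul (hf : Irreducible (quartic a b c))
    (hθ : aeval θ (quartic a b c) = 0) (hK : IntermediateField.adjoin ℚ {θ} = ⊤) {k m : ℕ}
    {e u w : ℤ} (hs : ¬ (3 : ℤ) ∣ s)
    (h₀ : s ^ 4 + a * s ^ 2 + b * s + c = 3 ^ (k + 3) * e)
    (h₁ : 4 * s ^ 3 + 2 * a * s + b = 3 ^ m * u)
    (h₂ : 6 * s ^ 2 + a = 3 * w) (he : ¬ (3 : ℤ) ∣ e) (hw : ¬ (3 : ℤ) ∣ w) (hm : k + 6 < 2 * m) :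
    IsPIntegralBasis 3 (tripleFamily 3 a b s θ ((k + 4) / 2 : ℕ) (1 : ℕ)) := by
  obtain ⟨D, hD, hD3⟩ := exists_discr_of_lt_two_mul hs h₀ h₁ h₂ he hw hm
  -- The discriminant of the family keeps only 3^(k % 2), never a factor 9.
  have hpow : k + 6 = 2 * ((k + 4) / 2 + 1) + k % 2 := by omega
  refine isPIntegralBasis_of_discr_quartic hf hθ hK (D := 3 ^ (k % 2) * D)
    (by rw [hD, hpow, pow_add]; ring_nf) ?_ ?_
  · rcases Nat.mod_two_eq_zero_or_one k with h | h <;> rw [h] <;> omega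
  have he0 : e ≠ 0 := by rintro rfl; exact he (dvd_zero _)
  have hrel := aeval_quartic_eq_devCoeff hθ h₀ h₁ h₂
  have hθi := isIntegral_of_aeval_quartic hθ
  have hcubic : ∀ ν : ℕ, ν ≤ m → 2 * ν ≤ k + 4 →
      IsIntegral ℤ (((θ - s) ^ 3 + (4 * s : ℤ) * (θ - s) ^ 2 + (3 * w : ℤ) * (θ - s)
        + (3 ^ m * u : ℤ)) / 3 ^ ν) := by
    intro ν hν hν2
    refine isIntegral_cubic_quotient_div hrel (mul_ne_zero (by positivity) he0) ?_ ?_ ?_ ?_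
    · exact (pow_dvd_pow _ hν).mul_right _
    -- The coefficient a₂a₀ is the one that requires 2ν ≤ k + 4; the divisibilities for a₃a₀² and
    -- a₀³ then follow.
    · rw [show 3 * w * (3 ^ (k + 3) * e) = 3 ^ (k + 4) * (w * e) by ring]
      exact (pow_dvd_pow _ hν2).mul_right _
    · rw [show 4 * s * (3 ^ (k + 3) * e) ^ 2 = 3 ^ (2 * k + 6) * (4 * s * e ^ 2) by ring]
      exact (pow_dvd_pow _ (by omega)).mul_right _
    · rw [show (3 ^ (k + 3) * e) ^ 3 = 3 ^ (3 * k + 9) * e ^ 3 by ring]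
      exact (pow_dvd_pow _ (by omega)).mul_right _
  rw [tripleFamily_eq_devCoeff h₁ h₂]
  intro i
  fin_cases i
  · exact isIntegral_one
  · exact hθi
  · have h9 : (9 : ℤ) = 3 ^ 2 := by norm_num
    have := isIntegral_quadratic_quotient_div hrel
      (h9 ▸ (pow_dvd_pow _ (by omega)).mul_right _) (h9 ▸ (pow_dvd_pow _ (by omega)).mul_right _)
      (dvd_mul_right _ _) (by have := hcubic 2 (by omega) (by omega); norm_num at this ⊢; exact this)
    simpa using this
  · exact hcubic _ (by omega) (by omega)

/-- The two homomorphisms to fields of characteristic `3` that witness the factorization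
`f ≡ x (x - s) ^ 3`. -/
lemma exists_ringHom_pair (hf : Irreducible (quartic a b c)) {ϑ : 𝓞 K}
    (hϑ : aeval ϑ (quartic a b c) = 0) (hs : ¬ (3 : ℤ) ∣ s) (hc : (3 : ℤ) ∣ c)
    (h : (3 : ℤ) ∣ s ^ 4 + a * s ^ 2 + b * s + c) :
    (∃ (F : Type v) (_ : Field F) (_ : CharP F 3) (φ : 𝓞 K →+* F), φ (ϑ - s) = 0) ∧
    ∃ (F : Type v) (_ : Field F) (_ : CharP F 3) (ψ : 𝓞 K →+* F), ψ (ϑ - s) ≠ 0 := by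
  have h3 : Fact (Nat.Prime 3) := ⟨Nat.prime_three⟩
  constructor
  · obtain ⟨F, i, hF, φ, hφ⟩ := exists_ringHom_of_dvd_eval (p := 3) hf hϑ (t := s)
      (by rw [eval_quartic]; exact_mod_cast h)
    exact ⟨F, i, hF, φ, by rw [map_sub, hφ, map_intCast, sub_self]⟩
  · obtain ⟨F, i, hF, ψ, hψ⟩ := exists_ringHom_of_dvd_eval (p := 3) hf hϑ (t := 0)
      (by rw [eval_quartic]; simpa using hc)
    refine ⟨F, i, hF, ψ, fun h0 => hs (three_dvd_of_map_eq_zero ψ ?_)⟩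
    rw [map_sub, hψ, Int.cast_zero, zero_sub, neg_eq_zero] at h0
    exact h0

/-- Here 27 ∣ disc(f) while no power of 3 is removed, so the discriminant criterion is useless and
saturation is used. -/
lemma isPIntegralBasis_of_slope_one_third (hf : Irreducible (quartic a b c))
    (hθ : aeval θ (quartic a b c) = 0) (hK : IntermediateField.adjoin ℚ {θ} = ⊤) {b₀ b₁ w : ℤ}
    (hs : ¬ (3 : ℤ) ∣ s) (hc : (3 : ℤ) ∣ c)
    (h₀ : s ^ 4 + a * s ^ 2 + b * s + c = 3 * b₀) (h₁ : 4 * s ^ 3 + 2 * a * s + b = 3 * b₁)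
    (h₂ : 6 * s ^ 2 + a = 3 * w) (hb₀ : ¬ (3 : ℤ) ∣ b₀) :
    IsPIntegralBasis 3 (tripleFamily 3 a b s θ (0 : ℕ) (0 : ℕ)) := by
  obtain ⟨ϑ, rfl⟩ : ∃ ϑ : 𝓞 K, (ϑ : K) = θ := ⟨⟨θ, isIntegral_of_aeval_quartic hθ⟩, rfl⟩
  have hrel := aeval_quartic_eq_devCoeff hθ h₀ h₁ h₂
  have hfam := tripleFamily_eq_devCoeff (θ := (ϑ : K)) h₁ h₂ 0 0
  have hint : ∀ i, IsIntegral ℤ (tripleFamily 3 a b s (ϑ : K) (0 : ℕ) (0 : ℕ) i) := by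
    rw [hfam]
    have hθi : IsIntegral ℤ (ϑ : K) := ϑ.isIntegral_coe
    have hηi : IsIntegral ℤ ((ϑ : K) - s) := hθi.sub (isIntegral_intCast _)
    intro i
    fin_cases i
    · exact isIntegral_one
    · exact hθi
    · simpa using ((hηi.pow 2).add ((isIntegral_intCast (4 * s)).mul hηi)).add
        (isIntegral_intCast (3 * w))
    · simpa using (((hηi.pow 3).add ((isIntegral_intCast (4 * s)).mul (hηi.pow 2))).add
        ((isIntegral_intCast (3 * w)).mul hηi)).add (isIntegral_intCast (3 * b₁))
  refine isPIntegralBasis_of_saturated Nat.prime_three hint (card_fin_four_eq_finrank hf hθ hK)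
    (linearIndependent_tripleFamily hf hθ hK 0 0) fun R z₀ hz h => ?_
  obtain ⟨z, rfl⟩ : ∃ z : 𝓞 K, (z : K) = z₀ := ⟨⟨z₀, hz⟩, rfl⟩
  have hϑ : aeval ϑ (quartic a b c) = 0 := by
    refine RingOfIntegers.coe_injective ?_
    rw [aeval_quartic] at hθ ⊢
    simpa only [map_add, map_mul, map_pow, map_intCast, map_zero] using hθ
  obtain ⟨⟨F₁, _, _, φ, hφ⟩, F₂, _, _, ψ, hψ⟩ :=
    exists_ringHom_pair hf hϑ hs hc ⟨b₀, h₀⟩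
  have h' : 3 * z = R 0 + R 1 * ((ϑ - s) + s)
      + R 2 * ((ϑ - s) ^ 2 + (4 * s : ℤ) * (ϑ - s) + 3 * w)
      + R 3 * ((ϑ - s) ^ 3 + (4 * s : ℤ) * (ϑ - s) ^ 2 + 3 * w * (ϑ - s) + 3 * b₁) := by
    refine RingOfIntegers.coe_injective ?_
    rw [hfam] at h
    simp only [map_add, map_sub, map_mul, map_pow, map_intCast, map_ofNat]
    simp [Fin.sum_univ_four] at h ⊢
    linear_combination h
  have hrel' : (ϑ - s) ^ 4 + (4 * s : ℤ) * (ϑ - s) ^ 3 + 3 * w * (ϑ - s) ^ 2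
      + 3 * b₁ * (ϑ - s) + 3 * b₀ = 0 := by
    refine RingOfIntegers.coe_injective ?_
    simp only [map_add, map_sub, map_mul, map_pow, map_intCast, map_ofNat, map_zero]
    simpa using hrel
  obtain ⟨d0, d1, d2, d3⟩ := three_dvd_of_slope_one_third φ ψ hφ hψ hrel' hb₀ h'
  intro i
  fin_cases i <;> assumption

/-- Here disc(f) has valuation 5 and only 3² is removed, so saturation is used again. -/
lemma isPIntegralBasis_of_slope_two_thirds (hf : Irreducible (quartic a b c))
    (hθ : aeval θ (quartic a b c) = 0) (hK : IntermediateField.adjoin ℚ {θ} = ⊤) {b₀ b₁ w : ℤ}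
    (hs : ¬ (3 : ℤ) ∣ s) (hc : (3 : ℤ) ∣ c)
    (h₀ : s ^ 4 + a * s ^ 2 + b * s + c = 9 * b₀) (h₁ : 4 * s ^ 3 + 2 * a * s + b = 9 * b₁)
    (h₂ : 6 * s ^ 2 + a = 3 * w) (hb₀ : ¬ (3 : ℤ) ∣ b₀) :
    IsPIntegralBasis 3 (tripleFamily 3 a b s θ (1 : ℕ) (0 : ℕ)) := by
  obtain ⟨ϑ, rfl⟩ : ∃ ϑ : 𝓞 K, (ϑ : K) = θ := ⟨⟨θ, isIntegral_of_aeval_quartic hθ⟩, rfl⟩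
  have hb0 : b₀ ≠ 0 := by rintro rfl; exact hb₀ (dvd_zero _)
  have hrel := aeval_quartic_eq_devCoeff hθ h₀ h₁ h₂
  have hfam := tripleFamily_eq_devCoeff (θ := (ϑ : K)) h₁ h₂ 1 0
  have h1 := isIntegral_cubic_quotient_div (ν := 1) hrel (by omega) ⟨3 * b₁, by ring⟩
    ⟨3 * w * b₀, by ring⟩ ⟨12 * s * b₀ ^ 2, by ring⟩ ⟨9 * b₀ ^ 3, by ring⟩
  have hint : ∀ i, IsIntegral ℤ (tripleFamily 3 a b s (ϑ : K) (1 : ℕ) (0 : ℕ) i) := by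
    rw [hfam]
    have hθi : IsIntegral ℤ (ϑ : K) := ϑ.isIntegral_coe
    have hηi : IsIntegral ℤ ((ϑ : K) - s) := hθi.sub (isIntegral_intCast _)
    intro i
    fin_cases i
    · exact isIntegral_one
    · exact hθi
    · simpa using ((hηi.pow 2).add ((isIntegral_intCast (4 * s)).mul hηi)).add
        (isIntegral_intCast (3 * w))
    · exact h1
  refine isPIntegralBasis_of_saturated Nat.prime_three hint (card_fin_four_eq_finrank hf hθ hK)
    (linearIndependent_tripleFamily hf hθ hK 1 0) fun R z₀ hz h => ?_
  obtain ⟨z, rfl⟩ : ∃ z : 𝓞 K, (z : K) = z₀ := ⟨⟨z₀, hz⟩, rfl⟩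
  have hϑ : aeval ϑ (quartic a b c) = 0 := by
    refine RingOfIntegers.coe_injective ?_
    rw [aeval_quartic] at hθ ⊢
    simpa only [map_add, map_mul, map_pow, map_intCast, map_zero] using hθ
  obtain ⟨⟨F₁, _, _, φ, hφ⟩, F₂, _, _, ψ, hψ⟩ :=
    exists_ringHom_pair hf hϑ hs hc ⟨3 * b₀, by rw [h₀]; ring⟩
  obtain ⟨ρ, hρK⟩ : ∃ ρ : 𝓞 K, (ρ : K) = (((ϑ : K) - s) ^ 3
      + (4 * s : ℤ) * (ϑ - s) ^ 2 + (3 * w : ℤ) * (ϑ - s) + (9 * b₁ : ℤ)) / 3 ^ 1 :=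
    ⟨⟨_, h1⟩, rfl⟩
  push_cast at hρK
  have h' : 3 * z = R 0 + R 1 * ((ϑ - s) + s)
      + R 2 * ((ϑ - s) ^ 2 + (4 * s : ℤ) * (ϑ - s) + 3 * w) + R 3 * ρ := by
    refine RingOfIntegers.coe_injective ?_
    rw [hfam] at h
    simp only [map_add, map_sub, map_mul, map_pow, map_intCast, map_ofNat]
    simp [Fin.sum_univ_four] at h ⊢
    linear_combination h - R 3 * hρK
  have hρ : 3 * ρ = (ϑ - s) ^ 3 + (4 * s : ℤ) * (ϑ - s) ^ 2
      + 3 * w * (ϑ - s) + 9 * b₁ := by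
    refine RingOfIntegers.coe_injective ?_
    simp only [map_add, map_sub, map_mul, map_pow, map_intCast, map_ofNat]
    push_cast
    linear_combination 3 * hρK
  have hrel' : (ϑ - s) ^ 4 + (4 * s : ℤ) * (ϑ - s) ^ 3 + 3 * w * (ϑ - s) ^ 2
      + 9 * b₁ * (ϑ - s) + 9 * b₀ = 0 := by
    refine RingOfIntegers.coe_injective ?_
    simp only [map_add, map_sub, map_mul, map_pow, map_intCast, map_ofNat, map_zero]
    simpa using hrel
  obtain ⟨d0, d1, d2, d3⟩ :=
    three_dvd_of_slope_two_thirds φ ψ hφ hψ hrel' hb₀ (by omega) hρ h'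
  intro i
  fin_cases i <;> assumption

end TripleFamily

/-! ### Newton polygons and residual polynomials in general -/

section NewtonPolygon

variable {p : ℕ} {f : ℤ[X]} {s : ℤ} {i j : ℕ}

/-- On an interval between two abscissas, a chord below all the points is the Newton polygon. -/
lemma newtonOrdinate_eq_of_chord (α β : ℝ) (hij : i < j) (hi : devCoeff f s i ≠ 0)
    (hj : devCoeff f s j ≠ 0) (hvi : (padicValInt p (devCoeff f s i) : ℝ) = α + β * i)
    (hvj : (padicValInt p (devCoeff f s j) : ℝ) = α + β * j)
    (hle : ∀ k, devCoeff f s k ≠ 0 → α + β * k ≤ padicValInt p (devCoeff f s k))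
    {x : ℝ} (hx : x ∈ Set.Icc (i : ℝ) j) : newtonOrdinate p f s x = α + β * x := by
  have hij' : (0 : ℝ) < j - i := sub_pos.2 (by exact_mod_cast hij)
  -- The chord lies in the hull and the hull lies in the half-plane above its line. Attainment as a
  -- least element gives the value of `sInf` at once.
  have hleast : IsLeast {y : ℝ | (x, y) ∈ convexHull ℝ (newtonPoints p f s)} (α + β * x) := by
    constructor
    · have hmi : ((i : ℝ), α + β * i) ∈ convexHull ℝ (newtonPoints p f s) :=
        subset_convexHull ℝ _ ⟨i, hi, by rw [hvi]⟩
      have hmj : ((j : ℝ), α + β * j) ∈ convexHull ℝ (newtonPoints p f s) :=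
        subset_convexHull ℝ _ ⟨j, hj, by rw [hvj]⟩
      have := (convex_convexHull ℝ (newtonPoints p f s)) hmi hmj
        (div_nonneg (sub_nonneg.2 hx.2) hij'.le) (div_nonneg (sub_nonneg.2 hx.1) hij'.le)
        (by field_simp; ring)
      have e : ((x, α + β * x) : ℝ × ℝ) = (((j : ℝ) - x) / (j - i)) • ((i : ℝ), α + β * i)
          + ((x - i) / ((j : ℝ) - i)) • ((j : ℝ), α + β * j) := by
        ext
        · simp only [Prod.smul_mk, Prod.mk_add_mk, smul_eq_mul]
          field_simp
          ring
        · simp only [Prod.smul_mk, Prod.mk_add_mk, smul_eq_mul]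
          field_simp
          ring
      rw [Set.mem_ofPred_eq, e]
      exact this
    · intro y hy
      have hconv : Convex ℝ {P : ℝ × ℝ | α + β * P.1 ≤ P.2} := by
        intro P hP Q hQ u v hu hv huv
        simp only [Set.mem_ofPred_eq, Prod.fst_add, Prod.smul_fst, smul_eq_mul, Prod.snd_add,
          Prod.smul_snd] at *
        have h1 := mul_le_mul_of_nonneg_left hP hu
        have h2 := mul_le_mul_of_nonneg_left hQ hv
        have h3 : α = u * α + v * α := by rw [← add_mul, huv, one_mul]
        linarith
      have hsub : newtonPoints p f s ⊆ {P : ℝ × ℝ | α + β * P.1 ≤ P.2} := by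
        rintro _ ⟨k, hk, rfl⟩
        exact hle k hk
      exact convexHull_min hsub hconv hy
  exact hleast.csInf_eq

lemma isSegment_of_eqOn (α β : ℝ) (hd : (taylor s f).natTrailingDegree ≤ i) (hij : i < j)
    (hj : j ≤ (taylor s f).natDegree)
    (h : ∀ x ∈ Set.Icc (i : ℝ) j, newtonOrdinate p f s x = α + β * x) : IsSegment p f s i j := by
  refine ⟨hd, hij, hj, β, fun x hx => ?_⟩
  rw [h x hx, h i ⟨le_rfl, by exact_mod_cast hij.le⟩]
  ring

/-- Tested at three consecutive abscissas, this shows that no segment crosses a vertex. -/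
lemma IsSegment.two_mul_newtonOrdinate (h : IsSegment p f s i j) {k : ℕ} (hik : i ≤ k)
    (hkj : k + 2 ≤ j) {y₀ y₁ y₂ : ℝ} (h₀ : newtonOrdinate p f s k = y₀)
    (h₁ : newtonOrdinate p f s (k + 1 : ℕ) = y₁) (h₂ : newtonOrdinate p f s (k + 2 : ℕ) = y₂) :
    2 * y₁ = y₀ + y₂ := by
  obtain ⟨-, -, -, m, hm⟩ := h
  have hik' : (i : ℝ) ≤ k := by exact_mod_cast hik
  have hkj' : (k : ℝ) + 2 ≤ j := by exact_mod_cast hkj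
  rw [← h₀, ← h₁, ← h₂, hm k ⟨hik', by linarith⟩,
    hm (k + 1 : ℕ) ⟨by push_cast; linarith, by push_cast; linarith⟩,
    hm (k + 2 : ℕ) ⟨by push_cast; linarith, by push_cast; linarith⟩]
  push_cast
  ring

lemma IsSide.eq_of_isSegment (h : IsSide p f s i j) {i' j' : ℕ} (h' : IsSegment p f s i' j')
    (hi : i' ≤ i) (hj : j ≤ j') : i = i' ∧ j = j' := by
  obtain ⟨h1, h2⟩ := h.2 i' j' hi hj h'
  exact ⟨h1.symm, h2.symm⟩

lemma residualCoeff_ne_zero [Fact p.Prime] (hi : devCoeff f s i ≠ 0)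
    (h : newtonOrdinate p f s i = padicValInt p (devCoeff f s i)) :
    residualCoeff p f s i ≠ 0 := by
  rw [residualCoeff, if_pos ⟨hi, h.symm⟩, Ne, ZMod.intCast_zmod_eq_zero_iff_dvd]
  intro hd
  have hdvd : (p : ℤ) ^ padicValInt p (devCoeff f s i) ∣ devCoeff f s i := padicValInt_dvd _
  have := mul_dvd_mul_left ((p : ℤ) ^ padicValInt p (devCoeff f s i)) hd
  rw [Int.mul_ediv_cancel' hdvd, ← pow_succ, padicValInt_dvd_iff] at this
  omega

lemma residualCoeff_eq_zero {y : ℝ} (hy : newtonOrdinate p f s i = y)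
    (h : devCoeff f s i ≠ 0 → (padicValInt p (devCoeff f s i) : ℝ) ≠ y) :
    residualCoeff p f s i = 0 := by
  rw [residualCoeff, if_neg]
  rintro ⟨h0, h1⟩
  exact h h0 (h1.trans hy)

lemma residualPoly_of_slope {q : ℚ} (hq : newtonSlope p f s i j = q) {d e : ℕ} (hden : q.den = e)
    (hde : j - i = d * e) :
    residualPoly p f s i j =
      ∑ k ∈ Finset.range (d + 1), C (residualCoeff p f s (i + k * e)) * X ^ k := by
  have he : 0 < e := hden ▸ q.den_pos
  rw [residualPoly, hq, hden, hde, Nat.mul_div_cancel _ he]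

lemma separable_linear {F : Type*} [Field F] {u v : F} (hv : v ≠ 0) :
    (C u + C v * X).Separable := by
  refine ⟨0, C v⁻¹, ?_⟩
  simp only [derivative_add, derivative_C, derivative_mul, derivative_X, zero_mul, zero_add,
    mul_one]
  rw [← C_mul, inv_mul_cancel₀ hv, C_1]

/-- In characteristic `3`, a cubic without linear term but with nonzero constant and quadratic
terms is separable. -/
lemma separable_cubic {F : Type*} [Field F] [CharP F 3] {u v w : F} (hu : u ≠ 0) (hv : v ≠ 0) :
    (C u + C v * X ^ 2 + C w * X ^ 3).Separable := by
  have h3 : (3 : F) = 0 := by exact_mod_cast CharP.cast_eq_zero F 3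
  have h3' : (3 : F[X]) = 0 := by rw [← C_ofNat, h3, C_0]
  have hu' : C u * C u⁻¹ = 1 := by rw [← C_mul, mul_inv_cancel₀ hu, C_1]
  have hv' : C v * C v⁻¹ = 1 := by rw [← C_mul, mul_inv_cancel₀ hv, C_1]
  -- The derivative is 2vX = -vX in characteristic 3, so a multiple of it cancels vX² + wX³. No
  -- condition on w is needed; w = 0 covers the quadratic case.
  refine ⟨C u⁻¹, C u⁻¹ * C v⁻¹ * (C v * X + C w * X ^ 2), ?_⟩
  have hder : derivative (C u + C v * X ^ 2 + C w * X ^ 3) = -(C v * X) := by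
    simp only [derivative_add, derivative_C, derivative_mul, derivative_X_pow, C_eq_natCast]
    push_cast
    linear_combination (C v * X + C w * X ^ 2) * h3'
  rw [hder]
  linear_combination hu' - C u⁻¹ * (C v * X ^ 2 + C w * X ^ 3) * hv'

end NewtonPolygon

/-! ### Polygons of quartics with a triple root modulo 3 -/

section TriplePolygon

/-- The points `(0, n)`, `(2, 1)`, `(3, 0)`, `(4, 0)` of the Newton polygon of a monic quartic
polynomial with a triple root modulo `3`. -/
structure HasTriplePoints (f : ℤ[X]) (s : ℤ) (n : ℕ) : Prop where
  natDegree : (taylor s f).natDegree = 4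
  ne_zero₀ : devCoeff f s 0 ≠ 0
  ne_zero₂ : devCoeff f s 2 ≠ 0
  ne_zero₃ : devCoeff f s 3 ≠ 0
  ne_zero₄ : devCoeff f s 4 ≠ 0
  val₀ : padicValInt 3 (devCoeff f s 0) = n
  val₂ : padicValInt 3 (devCoeff f s 2) = 1
  val₃ : padicValInt 3 (devCoeff f s 3) = 0
  val₄ : padicValInt 3 (devCoeff f s 4) = 0

namespace HasTriplePoints

variable {f : ℤ[X]} {s : ℤ} {n : ℕ}

lemma natTrailingDegree (H : HasTriplePoints f s n) : (taylor s f).natTrailingDegree = 0 :=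
  natTrailingDegree_eq_zero.2 (Or.inr H.ne_zero₀)

/-- Coefficients vanish beyond degree 4, so a line lies below the polygon once this is checked at
five abscissas. -/
lemma le_padicValInt (H : HasTriplePoints f s n) {α β : ℝ} (h₀ : α ≤ n)
    (h₁ : devCoeff f s 1 ≠ 0 → α + β ≤ padicValInt 3 (devCoeff f s 1)) (h₂ : α + β * 2 ≤ 1)
    (h₃ : α + β * 3 ≤ 0) (h₄ : α + β * 4 ≤ 0) :
    ∀ k, devCoeff f s k ≠ 0 → α + β * k ≤ padicValInt 3 (devCoeff f s k) := by
  intro k hk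
  have hk4 : k ≤ 4 := by
    rw [← H.natDegree]
    exact le_natDegree_of_ne_zero hk
  interval_cases k
  · simpa [H.val₀] using h₀
  · simpa using h₁ hk
  · simpa [H.val₂] using h₂
  · simpa [H.val₃] using h₃
  · simpa [H.val₄] using h₄

lemma isSegment (H : HasTriplePoints f s n) {i j : ℕ} (α β : ℝ) (hij : i < j) (hj : j ≤ 4)
    (h : ∀ x ∈ Set.Icc (i : ℝ) j, newtonOrdinate 3 f s x = α + β * x) : IsSegment 3 f s i j :=
  isSegment_of_eqOn α β (by rw [H.natTrailingDegree]; exact Nat.zero_le _) hij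
    (by rwa [H.natDegree]) h

lemma newtonOrdinate_three_four (H : HasTriplePoints f s n) :
    ∀ x ∈ Set.Icc ((3 : ℕ) : ℝ) (4 : ℕ), newtonOrdinate 3 f s x = 0 + 0 * x := fun x hx =>
  newtonOrdinate_eq_of_chord 0 0 (by norm_num) H.ne_zero₃ H.ne_zero₄ (by simp [H.val₃])
    (by simp [H.val₄]) (H.le_padicValInt (by positivity) (fun _ => by simp) (by norm_num)
    (by norm_num) (by norm_num)) hx

lemma newtonSlope_three_four (H : HasTriplePoints f s n) : newtonSlope 3 f s 3 4 = 0 := by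
  simp [newtonSlope, H.val₃, H.val₄]

lemma newtonOrdinate_three (H : HasTriplePoints f s n) :
    newtonOrdinate 3 f s ((3 : ℕ) : ℝ) = 0 := by
  rw [H.newtonOrdinate_three_four _ ⟨le_rfl, by norm_num⟩]; ring

lemma newtonOrdinate_four (H : HasTriplePoints f s n) :
    newtonOrdinate 3 f s ((4 : ℕ) : ℝ) = 0 := by
  rw [H.newtonOrdinate_three_four _ ⟨by norm_num, le_rfl⟩]; ring

lemma lt_and_le_four (H : HasTriplePoints f s n) {i j : ℕ} (h : IsSegment 3 f s i j) :
    i < j ∧ j ≤ 4 := ⟨h.2.1, H.natDegree ▸ h.2.2.1⟩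

/-! ### A single side of negative slope -/

lemma newtonOrdinate_zero_three (H : HasTriplePoints f s n) (hn : n ≤ 3)
    (h₁ : devCoeff f s 1 ≠ 0 → 2 * n ≤ 3 * padicValInt 3 (devCoeff f s 1)) :
    ∀ x ∈ Set.Icc ((0 : ℕ) : ℝ) (3 : ℕ), newtonOrdinate 3 f s x = n + (-n / 3) * x := by
  have hn' : (n : ℝ) ≤ 3 := by exact_mod_cast hn
  have hn0 : (0 : ℝ) ≤ n := by positivity
  refine fun x hx => newtonOrdinate_eq_of_chord _ _ (by norm_num) H.ne_zero₀ H.ne_zero₃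
    (by simp [H.val₀]) (by simp [H.val₃]) (H.le_padicValInt le_rfl (fun h => ?_)
    (by linarith) (by linarith) (by linarith)) hx
  have : 2 * (n : ℝ) ≤ 3 * padicValInt 3 (devCoeff f s 1) := by exact_mod_cast h₁ h
  linarith

lemma isSide_of_one_side (H : HasTriplePoints f s n) (hn0 : 0 < n) (hn : n ≤ 3)
    (h₁ : devCoeff f s 1 ≠ 0 → 2 * n ≤ 3 * padicValInt 3 (devCoeff f s 1)) {i j : ℕ}
    (h : IsSide 3 f s i j) : (i = 0 ∧ j = 3) ∨ (i = 3 ∧ j = 4) := by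
  have hY := H.newtonOrdinate_zero_three hn h₁
  have s₁ := H.isSegment _ _ (by norm_num) (by norm_num) hY
  have s₂ := H.isSegment _ _ (by norm_num) le_rfl H.newtonOrdinate_three_four
  obtain ⟨hij, hj⟩ := H.lt_and_le_four h.1
  rcases Nat.lt_or_ge 3 j with hj3 | hj3
  · rcases Nat.lt_or_ge i 3 with hi3 | hi3
    · have := h.1.two_mul_newtonOrdinate (k := 2) (by omega) (by omega)
        (hY _ ⟨by norm_num, by norm_num⟩) H.newtonOrdinate_three H.newtonOrdinate_four
      have : (0 : ℝ) < n := by exact_mod_cast hn0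
      push_cast at *
      linarith
    · exact Or.inr (h.eq_of_isSegment s₂ hi3 hj)
  · exact Or.inl (h.eq_of_isSegment s₁ (Nat.zero_le _) hj3)

lemma isRegularAt_of_one_side (H : HasTriplePoints f s n) (hn0 : 0 < n) (hn : n ≤ 3)
    (h₁ : devCoeff f s 1 ≠ 0 → 2 * n ≤ 3 * padicValInt 3 (devCoeff f s 1))
    (h₁' : n = 3 → devCoeff f s 1 ≠ 0 → 2 < padicValInt 3 (devCoeff f s 1)) :
    IsRegularAt 3 f s := by
  have : Fact (Nat.Prime 3) := ⟨Nat.prime_three⟩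
  intro i j h hslope
  have hY := H.newtonOrdinate_zero_three hn h₁
  rcases H.isSide_of_one_side hn0 hn h₁ h with ⟨rfl, rfl⟩ | ⟨rfl, rfl⟩
  · have hq : newtonSlope 3 f s 0 3 = -n / 3 := by simp [newtonSlope, H.val₀, H.val₃]
    have c₀ : residualCoeff 3 f s 0 ≠ 0 := residualCoeff_ne_zero H.ne_zero₀ (by
      rw [hY _ ⟨le_rfl, by norm_num⟩, H.val₀]; simp)
    have c₃ : residualCoeff 3 f s 3 ≠ 0 := residualCoeff_ne_zero H.ne_zero₃ (by
      rw [H.newtonOrdinate_three, H.val₃]; simp)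
    interval_cases n
    · rw [residualPoly_of_slope hq (d := 1) (e := 3) (by norm_num) rfl]
      simpa [Finset.sum_range_succ] using separable_linear (u := residualCoeff 3 f s 0) c₃
    · rw [residualPoly_of_slope hq (d := 1) (e := 3) (by norm_num) rfl]
      simpa [Finset.sum_range_succ] using separable_linear (u := residualCoeff 3 f s 0) c₃
    -- For n = 3 the slope is -1 and (2, 1) lies on the side, whereas the point at abscissa 1 is
    -- strictly above it: the residual polynomial is c₀ + c₂y² + c₃y³.
    · rw [residualPoly_of_slope hq (d := 3) (e := 1) (by norm_num) rfl]
      have c₂ : residualCoeff 3 f s 2 ≠ 0 := residualCoeff_ne_zero H.ne_zero₂ (by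
        rw [hY _ ⟨by norm_num, by norm_num⟩, H.val₂]; norm_num)
      have c₁ : residualCoeff 3 f s 1 = 0 :=
        residualCoeff_eq_zero (hY _ ⟨by norm_num, by norm_num⟩) (fun h0 => by
          have : (2 : ℝ) < padicValInt 3 (devCoeff f s 1) := by exact_mod_cast h₁' rfl h0
          push_cast
          linarith)
      simpa [Finset.sum_range_succ, c₁] using
        separable_cubic (w := residualCoeff 3 f s 3) c₀ c₂
  · rw [H.newtonSlope_three_four] at hslope
    exact absurd hslope (lt_irrefl 0)

/-! ### A vertex with abscissa `1` -/

lemma newtonOrdinate_zero_one (H : HasTriplePoints f s n) (hn : 2 ≤ n) (h₁ : devCoeff f s 1 ≠ 0)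
    (hv₁ : padicValInt 3 (devCoeff f s 1) = 1) :
    ∀ x ∈ Set.Icc ((0 : ℕ) : ℝ) (1 : ℕ), newtonOrdinate 3 f s x = n + (1 - n) * x := by
  have hn' : (2 : ℝ) ≤ n := by exact_mod_cast hn
  exact fun x hx => newtonOrdinate_eq_of_chord _ _ (by norm_num) H.ne_zero₀ h₁
    (by simp [H.val₀]) (by simp [hv₁]) (H.le_padicValInt le_rfl (fun h => by simp [hv₁])
    (by linarith) (by linarith) (by linarith)) hx

lemma newtonOrdinate_one_three (H : HasTriplePoints f s n) (hn : 2 ≤ n) (h₁ : devCoeff f s 1 ≠ 0)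
    (hv₁ : padicValInt 3 (devCoeff f s 1) = 1) :
    ∀ x ∈ Set.Icc ((1 : ℕ) : ℝ) (3 : ℕ), newtonOrdinate 3 f s x = 3 / 2 + (-1 / 2) * x := by
  have hn' : (2 : ℝ) ≤ n := by exact_mod_cast hn
  exact fun x hx => newtonOrdinate_eq_of_chord _ _ (by norm_num) h₁ H.ne_zero₃
    (by simp [hv₁]; norm_num) (by simp [H.val₃]; norm_num)
    (H.le_padicValInt (by linarith) (fun h => by rw [hv₁]; norm_num)
    (by norm_num) (by norm_num) (by norm_num)) hx

lemma isSide_of_vertex_one (H : HasTriplePoints f s n) (hn : 2 ≤ n) (h₁ : devCoeff f s 1 ≠ 0)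
    (hv₁ : padicValInt 3 (devCoeff f s 1) = 1) {i j : ℕ} (h : IsSide 3 f s i j) :
    (i = 0 ∧ j = 1) ∨ (i = 1 ∧ j = 3) ∨ (i = 3 ∧ j = 4) := by
  have hY := H.newtonOrdinate_zero_one hn h₁ hv₁
  have hY' := H.newtonOrdinate_one_three hn h₁ hv₁
  have s₁ := H.isSegment _ _ (by norm_num) (by norm_num) hY
  have s₂ := H.isSegment _ _ (by norm_num) (by norm_num) hY'
  have s₃ := H.isSegment _ _ (by norm_num) le_rfl H.newtonOrdinate_three_four
  have hn' : (2 : ℝ) ≤ n := by exact_mod_cast hn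
  obtain ⟨hij, hj⟩ := H.lt_and_le_four h.1
  rcases Nat.lt_or_ge 3 j with hj3 | hj3
  · rcases Nat.lt_or_ge i 3 with hi3 | hi3
    · have := h.1.two_mul_newtonOrdinate (k := 2) (by omega) (by omega)
        (hY' _ ⟨by norm_num, by norm_num⟩) H.newtonOrdinate_three H.newtonOrdinate_four
      norm_num at this
    · exact Or.inr (Or.inr (h.eq_of_isSegment s₃ hi3 hj))
  · rcases Nat.lt_or_ge 1 j with hj1 | hj1
    · rcases Nat.lt_or_ge i 1 with hi1 | hi1
      · have := h.1.two_mul_newtonOrdinate (k := 0) (by omega) (by omega)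
          (hY _ ⟨by norm_num, by norm_num⟩) (hY _ ⟨by norm_num, by norm_num⟩)
          (hY' _ ⟨by norm_num, by norm_num⟩)
        push_cast at this
        linarith
      · exact Or.inr (Or.inl (h.eq_of_isSegment s₂ hi1 hj3))
    · exact Or.inl (h.eq_of_isSegment s₁ (Nat.zero_le _) hj1)

/-- Both negative sides have degree 1: one has length 1, the other length 2 and slope -1/2. -/
lemma isRegularAt_of_vertex_one (H : HasTriplePoints f s n) (hn : 2 ≤ n)
    (h₁ : devCoeff f s 1 ≠ 0) (hv₁ : padicValInt 3 (devCoeff f s 1) = 1) :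
    IsRegularAt 3 f s := by
  have : Fact (Nat.Prime 3) := ⟨Nat.prime_three⟩
  intro i j h hslope
  have c₁ : residualCoeff 3 f s 1 ≠ 0 := residualCoeff_ne_zero h₁ (by
    rw [H.newtonOrdinate_zero_one hn h₁ hv₁ _ ⟨by norm_num, le_rfl⟩, hv₁]; simp)
  have c₃ : residualCoeff 3 f s 3 ≠ 0 := residualCoeff_ne_zero H.ne_zero₃ (by
    rw [H.newtonOrdinate_three, H.val₃]; simp)
  rcases H.isSide_of_vertex_one hn h₁ hv₁ h with ⟨rfl, rfl⟩ | ⟨rfl, rfl⟩ | ⟨rfl, rfl⟩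
  · have hq : newtonSlope 3 f s 0 1 = ((1 - n : ℤ) : ℚ) := by
      simp [newtonSlope, H.val₀, hv₁]
    rw [residualPoly_of_slope hq (d := 1) (e := 1) (Rat.den_intCast _) rfl]
    simpa [Finset.sum_range_succ] using separable_linear (u := residualCoeff 3 f s 0) c₁
  · have hq : newtonSlope 3 f s 1 3 = -1 / 2 := by
      simp [newtonSlope, H.val₃, hv₁]; norm_num
    rw [residualPoly_of_slope hq (d := 1) (e := 2) (by norm_num) rfl]
    simpa [Finset.sum_range_succ] using separable_linear (u := residualCoeff 3 f s 1) c₃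
  · rw [H.newtonSlope_three_four] at hslope
    exact absurd hslope (lt_irrefl 0)

/-! ### A vertex with abscissa `2` -/

lemma newtonOrdinate_zero_two (H : HasTriplePoints f s n) (hn : 3 ≤ n)
    (h₁ : devCoeff f s 1 ≠ 0 → n + 1 ≤ 2 * padicValInt 3 (devCoeff f s 1)) :
    ∀ x ∈ Set.Icc ((0 : ℕ) : ℝ) (2 : ℕ), newtonOrdinate 3 f s x = n + ((1 - n) / 2) * x := by
  have hn' : (3 : ℝ) ≤ n := by exact_mod_cast hn
  refine fun x hx => newtonOrdinate_eq_of_chord _ _ (by norm_num) H.ne_zero₀ H.ne_zero₂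
    (by simp [H.val₀]) (by simp [H.val₂]) (H.le_padicValInt le_rfl (fun h => ?_)
    (by linarith) (by linarith) (by linarith)) hx
  have : (n : ℝ) + 1 ≤ 2 * padicValInt 3 (devCoeff f s 1) := by exact_mod_cast h₁ h
  linarith

lemma newtonOrdinate_two_three (H : HasTriplePoints f s n) (hn : 3 ≤ n)
    (h₁ : devCoeff f s 1 ≠ 0 → n + 1 ≤ 2 * padicValInt 3 (devCoeff f s 1)) :
    ∀ x ∈ Set.Icc ((2 : ℕ) : ℝ) (3 : ℕ), newtonOrdinate 3 f s x = 3 + (-1) * x := by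
  have hn' : (3 : ℝ) ≤ n := by exact_mod_cast hn
  refine fun x hx => newtonOrdinate_eq_of_chord _ _ (by norm_num) H.ne_zero₂ H.ne_zero₃
    (by rw [H.val₂]; norm_num) (by rw [H.val₃]; norm_num) (H.le_padicValInt hn' (fun h => ?_)
    (by norm_num) (by norm_num) (by norm_num)) hx
  have : (n : ℝ) + 1 ≤ 2 * padicValInt 3 (devCoeff f s 1) := by exact_mod_cast h₁ h
  linarith

lemma isSide_of_vertex_two (H : HasTriplePoints f s n) (hn : 3 < n)
    (h₁ : devCoeff f s 1 ≠ 0 → n + 1 ≤ 2 * padicValInt 3 (devCoeff f s 1)) {i j : ℕ}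
    (h : IsSide 3 f s i j) : (i = 0 ∧ j = 2) ∨ (i = 2 ∧ j = 3) ∨ (i = 3 ∧ j = 4) := by
  have hY := H.newtonOrdinate_zero_two hn.le h₁
  have hY' := H.newtonOrdinate_two_three hn.le h₁
  have s₁ := H.isSegment _ _ (by norm_num) (by norm_num) hY
  have s₂ := H.isSegment _ _ (by norm_num) (by norm_num) hY'
  have s₃ := H.isSegment _ _ (by norm_num) le_rfl H.newtonOrdinate_three_four
  have hn' : (3 : ℝ) < n := by exact_mod_cast hn
  obtain ⟨hij, hj⟩ := H.lt_and_le_four h.1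
  rcases Nat.lt_or_ge 3 j with hj3 | hj3
  · rcases Nat.lt_or_ge i 3 with hi3 | hi3
    · have := h.1.two_mul_newtonOrdinate (k := 2) (by omega) (by omega)
        (hY' _ ⟨by norm_num, by norm_num⟩) H.newtonOrdinate_three H.newtonOrdinate_four
      norm_num at this
    · exact Or.inr (Or.inr (h.eq_of_isSegment s₃ hi3 hj))
  · rcases Nat.lt_or_ge 2 j with hj2 | hj2
    · rcases Nat.lt_or_ge i 2 with hi2 | hi2
      · have := h.1.two_mul_newtonOrdinate (k := 1) (by omega) (by omega)
          (hY _ ⟨by norm_num, by norm_num⟩) (hY _ ⟨by norm_num, by norm_num⟩)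
          (hY' _ ⟨by norm_num, by norm_num⟩)
        push_cast at this
        linarith
      · exact Or.inr (Or.inl (h.eq_of_isSegment s₂ hi2 hj3))
    · exact Or.inl (h.eq_of_isSegment s₁ (Nat.zero_le _) hj2)

lemma isRegularAt_of_vertex_two (H : HasTriplePoints f s n) (hn : 3 < n)
    (h₁ : devCoeff f s 1 ≠ 0 → n + 1 < 2 * padicValInt 3 (devCoeff f s 1)) :
    IsRegularAt 3 f s := by
  have : Fact (Nat.Prime 3) := ⟨Nat.prime_three⟩
  have h₁' := fun h0 => (h₁ h0).le
  have hY := H.newtonOrdinate_zero_two hn.le h₁'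
  intro i j h hslope
  have c₀ : residualCoeff 3 f s 0 ≠ 0 := residualCoeff_ne_zero H.ne_zero₀ (by
    rw [hY _ ⟨le_rfl, by norm_num⟩, H.val₀]; simp)
  have c₂ : residualCoeff 3 f s 2 ≠ 0 := residualCoeff_ne_zero H.ne_zero₂ (by
    rw [hY _ ⟨by norm_num, le_rfl⟩, H.val₂]; push_cast; ring)
  have c₃ : residualCoeff 3 f s 3 ≠ 0 := residualCoeff_ne_zero H.ne_zero₃ (by
    rw [H.newtonOrdinate_three, H.val₃]; simp)
  rcases H.isSide_of_vertex_two hn h₁' h with ⟨rfl, rfl⟩ | ⟨rfl, rfl⟩ | ⟨rfl, rfl⟩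
  -- For n even the slope (1 - n)/2 has denominator 2 and the degree is 1. For n odd the residual
  -- polynomial is c₀ + c₂y², the strict bound on v(a₁) giving c₁ = 0.
  · obtain ⟨m, hm⟩ | ⟨m, hm⟩ := Nat.even_or_odd n
    · have hq : newtonSlope 3 f s 0 2 = ((1 - 2 * m : ℤ) : ℚ) / ((2 : ℤ) : ℚ) := by
        simp [newtonSlope, H.val₀, H.val₂, hm]; ring
      rw [residualPoly_of_slope hq (d := 1) (e := 2) ?_ rfl]
      · simpa [Finset.sum_range_succ] using separable_linear (u := residualCoeff 3 f s 0) c₂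
      · have hcop : Nat.Coprime (1 - 2 * m : ℤ).natAbs (2 : ℤ).natAbs :=
          Nat.coprime_two_right.2 (by rw [Int.natAbs_odd]; exact ⟨-m, by ring⟩)
        exact_mod_cast Rat.den_div_eq_of_coprime (by norm_num) hcop
    · have hq : newtonSlope 3 f s 0 2 = ((-m : ℤ) : ℚ) := by
        simp [newtonSlope, H.val₀, H.val₂, hm]; ring
      rw [residualPoly_of_slope hq (d := 2) (e := 1) (Rat.den_intCast _) rfl]
      have c₁ : residualCoeff 3 f s 1 = 0 :=
        residualCoeff_eq_zero (hY _ ⟨by norm_num, by norm_num⟩) (fun h0 => by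
          have : (n : ℝ) + 1 < 2 * padicValInt 3 (devCoeff f s 1) := by exact_mod_cast h₁ h0
          push_cast
          linarith)
      simpa [Finset.sum_range_succ, c₁] using separable_cubic (w := (0 : ZMod 3)) c₀ c₂
  · have hq : newtonSlope 3 f s 2 3 = ((-1 : ℤ) : ℚ) := by
      simp [newtonSlope, H.val₂, H.val₃]; norm_num
    rw [residualPoly_of_slope hq (d := 1) (e := 1) (Rat.den_intCast _) rfl]
    simpa [Finset.sum_range_succ] using separable_linear (u := residualCoeff 3 f s 2) c₃
  · rw [H.newtonSlope_three_four] at hslope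
    exact absurd hslope (lt_irrefl 0)

end HasTriplePoints

end TriplePolygon

/-! ### Good lifts: existence and consequences -/

section Quartic

variable {a b c s : ℤ}

lemma eval_quartic_ne_zero (hf : Irreducible (quartic a b c)) (s : ℤ) :
    (quartic a b c).eval s ≠ 0 := by
  intro h
  have hX : (X - C s : ℤ[X]).natDegree = 1 := natDegree_X_sub_C s
  rcases hf.dvd_iff.1 (dvd_iff_isRoot.2 h) with hu | ha
  · rw [natDegree_eq_zero_of_isUnit hu] at hX
    exact absurd hX (by norm_num)
  · have := natDegree_eq_of_degree_eq (degree_eq_degree_of_associated ha)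
    rw [quartic_natDegree, hX] at this
    exact absurd this (by norm_num)

lemma padicValInt_three_eq_zero {m : ℤ} (hm : ¬ (3 : ℤ) ∣ m) : padicValInt 3 m = 0 :=
  padicValInt.eq_zero_of_not_dvd (by exact_mod_cast hm)

lemma hasTriplePoints_quartic {n : ℕ} {e w : ℤ} (hs : ¬ (3 : ℤ) ∣ s)
    (h₀ : s ^ 4 + a * s ^ 2 + b * s + c = 3 ^ n * e) (he : ¬ (3 : ℤ) ∣ e)
    (h₂ : 6 * s ^ 2 + a = 3 * w) (hw : ¬ (3 : ℤ) ∣ w) :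
    HasTriplePoints (quartic a b c) s n where
  natDegree := by rw [natDegree_taylor, quartic_natDegree]
  ne_zero₀ := by
    rw [devCoeff_quartic_zero, h₀]
    exact mul_ne_zero (by positivity) (by rintro rfl; exact he (dvd_zero _))
  ne_zero₂ := by rw [devCoeff_quartic_two, h₂]; omega
  ne_zero₃ := by rw [devCoeff_quartic_three]; omega
  ne_zero₄ := by rw [devCoeff_quartic_four]; norm_num
  val₀ := by rw [devCoeff_quartic_zero, h₀, padicValInt_three_pow_mul he]
  val₂ := by
    rw [devCoeff_quartic_two, h₂]
    simpa using padicValInt_three_pow_mul (k := 1) hw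
  val₃ := by rw [devCoeff_quartic_three]; exact padicValInt_three_eq_zero (by omega)
  val₄ := by rw [devCoeff_quartic_four]; exact padicValInt_three_eq_zero (by norm_num)

lemma exists_isGoodLift (ha : a ≡ 0 [ZMOD 9] ∨ a ≡ 6 [ZMOD 9]) (hb : ¬ (3 : ℤ) ∣ b)
    (h : SecondCase a b c) : ∃ s : ℤ, IsGoodLift a b c s := by
  have h9 : 9 ∣ (derivative (quartic a b c)).eval (-b) := by
    have := (lt_val_iff (k := 1)).1 (by exact_mod_cast h.2)
    simpa using this
  obtain ⟨s, hs, hd⟩ := exists_pow_dvd_derivative ha hb h9 (discVal a b c)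
  refine ⟨s, hs, ?_⟩
  have h1 : ((discVal a b c + 1 : ℕ) : ℕ∞) < val 3 ((derivative (quartic a b c)).eval s) :=
    lt_val_iff.2 hd
  have h2 : (discVal a b c : ℕ∞) < val 3 ((derivative (quartic a b c)).eval s) :=
    lt_of_le_of_lt (by exact_mod_cast Nat.le_succ _) h1
  refine h2.trans_le ?_
  rw [two_mul]
  exact le_self_add

/-- A good lift has `f'(s)` divisible by a sufficiently high power of `3`. -/
lemma exists_pow_dvd_of_isGoodLift (h : IsGoodLift a b c s) (hdisc : (quartic a b c).discr ≠ 0)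
    {k : ℕ} {e w : ℤ} (h₀ : s ^ 4 + a * s ^ 2 + b * s + c = 3 ^ (k + 3) * e)
    (h₁ : 9 ∣ 4 * s ^ 3 + 2 * a * s + b) (h₂ : 6 * s ^ 2 + a = 3 * w) :
    ∃ m, 3 ^ m ∣ 4 * s ^ 3 + 2 * a * s + b ∧ k + 6 < 2 * m := by
  by_cases hz : 4 * s ^ 3 + 2 * a * s + b = 0
  -- If f'(s) = 0 any large exponent serves.
  · exact ⟨k + 7, by rw [hz]; exact dvd_zero _, by omega⟩
  obtain ⟨u, hu, hu3⟩ := (Int.finiteMultiplicity_iff (a := 3)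
    (b := 4 * s ^ 3 + 2 * a * s + b)).2 ⟨by norm_num, hz⟩ |>.exists_eq_pow_mul_and_not_dvd
  generalize multiplicity 3 (4 * s ^ 3 + 2 * a * s + b) = m at hu
  refine ⟨m, ⟨u, hu⟩, ?_⟩
  by_contra hm
  have hval : val 3 ((derivative (quartic a b c)).eval s) = m := by
    rw [eval_derivative_quartic, hu, val_eq_iff]
    refine ⟨dvd_mul_right _ _, fun hd => hu3 ?_⟩
    rw [pow_succ] at hd
    exact (mul_dvd_mul_iff_left (by positivity)).1 hd
  have hlt := h.2
  rw [hval] at hlt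
  have hlt' : discVal a b c < 2 * m := by exact_mod_cast hlt
  have hm2 : 2 ≤ m := by
    by_contra h2
    rw [hu] at h₁
    interval_cases m <;> omega
  have h3 : Fact (Nat.Prime 3) := ⟨Nat.prime_three⟩
  -- If 2m ≤ k + 6, then 3^(2m) ∣ disc(f), so 2m ≤ Δ, contrary to Δ < 2m.
  have hd := pow_dvd_discr h₀ hu hm2 h₂ (by omega)
  have := (padicValInt_dvd_iff (p := 3) (2 * m) (quartic a b c).discr).1 (by exact_mod_cast hd)
  rcases this with h0 | hle
  · exact hdisc h0
  · unfold discVal at hlt'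
    omega

end Quartic

theorem lemma4p4 {K : Type*} [Field K] [NumberField K] (a b c : ℤ)
    (hf : Irreducible (quartic a b c))
    (θ : K) (hθ : Polynomial.aeval θ (quartic a b c) = 0)
    (hK : IntermediateField.adjoin ℚ {θ} = ⊤)
    (ha : a ≡ 0 [ZMOD 9] ∨ a ≡ 6 [ZMOD 9]) (hb : ¬ (3 : ℤ) ∣ b) (hc : (3 : ℤ) ∣ c) :
    (SecondCase a b c → ∃ s : ℤ, IsGoodLift a b c s) ∧
    ∀ s : ℤ, (FirstCase a b c ∧ s = -b) ∨ (SecondCase a b c ∧ IsGoodLift a b c s) →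
      IsRegularAt 3 (quartic a b c) s ∧
      ∃ ν₁ ν₂ : ℤ,
        ν₁ = ⌊newtonOrdinate 3 (quartic a b c) s 1⌋ ∧
        ν₂ = ⌊newtonOrdinate 3 (quartic a b c) s 2⌋ ∧
        IsPIntegralBasis 3 (tripleFamily 3 a b s θ ν₁ ν₂) ∧
        -- the four rows of the table
        (val 3 ((quartic a b c).eval s) = 1 → ν₁ = 0 ∧ ν₂ = 0) ∧
        (val 3 ((quartic a b c).eval s) = 2 → ν₁ = 1 ∧ ν₂ = 0) ∧
        (1 < val 3 ((quartic a b c).eval s) →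
          val 3 ((Polynomial.derivative (quartic a b c)).eval s) = 1 → ν₁ = 1 ∧ ν₂ = 0) ∧
        (2 < val 3 ((quartic a b c).eval s) →
          1 < val 3 ((Polynomial.derivative (quartic a b c)).eval s) →
          ν₁ = (discVal a b c : ℤ) / 2 - 1 ∧ ν₂ = 1) ∧
        -- at least one of the rows applies
        (val 3 ((quartic a b c).eval s) = 1 ∨ val 3 ((quartic a b c).eval s) = 2 ∨
          (1 < val 3 ((quartic a b c).eval s) ∧
            val 3 ((Polynomial.derivative (quartic a b c)).eval s) = 1) ∨
          (2 < val 3 ((quartic a b c).eval s) ∧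
            1 < val 3 ((Polynomial.derivative (quartic a b c)).eval s))) := by
  refine ⟨exists_isGoodLift ha hb, fun s hcase => ?_⟩
  have hsb : s ≡ -b [ZMOD 3] := by
    rcases hcase with ⟨-, rfl⟩ | ⟨-, h⟩
    · rfl
    · exact h.1
  have ha3 : (3 : ℤ) ∣ a := by
    unfold Int.ModEq at ha
    omega
  have hs := not_three_dvd_of_modEq_neg hb hsb
  obtain ⟨w, h₂, hw⟩ := exists_devCoeff_two ha hs
  obtain ⟨hd₀, hd₁⟩ := three_dvd_eval ha3 hc hb hsb
  have hne := eval_quartic_ne_zero hf s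
  obtain ⟨e, he, he3⟩ := (Int.finiteMultiplicity_iff (a := 3)
    (b := (quartic a b c).eval s)).2 ⟨by norm_num, hne⟩ |>.exists_eq_pow_mul_and_not_dvd
  generalize multiplicity 3 ((quartic a b c).eval s) = n at he
  have hn0 : 0 < n := by
    rcases Nat.eq_zero_or_pos n with rfl | h
    · rw [he, pow_zero, one_mul] at hd₀
      exact absurd hd₀ he3
    · exact h
  have hval₀ : val 3 ((quartic a b c).eval s) = n := by
    rw [he, val_eq_iff]
    refine ⟨dvd_mul_right _ _, fun hd => he3 ?_⟩
    rw [pow_succ] at hd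
    exact (mul_dvd_mul_iff_left (by positivity)).1 hd
  have hval₁ : val 3 ((derivative (quartic a b c)).eval s) = 1 ↔
      ¬ 9 ∣ (derivative (quartic a b c)).eval s := by
    have := val_eq_iff (k := 1) (n := (derivative (quartic a b c)).eval s)
    norm_num at this
    rw [this]
    exact and_iff_right hd₁
  have hval₁' : 1 < val 3 ((derivative (quartic a b c)).eval s) ↔
      9 ∣ (derivative (quartic a b c)).eval s := by
    have := lt_val_iff (k := 1) (n := (derivative (quartic a b c)).eval s)
    norm_num at this
    exact this
  have e1 : (n : ℕ∞) = 1 ↔ n = 1 := by exact_mod_cast Iff.rfl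
  have e2 : (n : ℕ∞) = 2 ↔ n = 2 := by exact_mod_cast Iff.rfl
  have l1 : (1 : ℕ∞) < n ↔ 1 < n := by exact_mod_cast Iff.rfl
  have l2 : (2 : ℕ∞) < n ↔ 2 < n := by exact_mod_cast Iff.rfl
  simp only [hval₀, hval₁, hval₁', e1, e2, l1, l2]
  have h₀ := he
  rw [eval_quartic] at h₀
  have hder := eval_derivative_quartic a b c s
  rw [hder] at hd₁ ⊢
  have hdev₁ := devCoeff_quartic_one a b c s
  have H := hasTriplePoints_quartic hs h₀ he3 h₂ hw
  have h3 : Fact (Nat.Prime 3) := ⟨Nat.prime_three⟩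
  -- The nonvanishing hypothesis is essential: `padicValInt` takes the value 0 at 0.
  have hle : ∀ m : ℕ, (3 : ℤ) ^ m ∣ 4 * s ^ 3 + 2 * a * s + b →
      devCoeff (quartic a b c) s 1 ≠ 0 → m ≤ padicValInt 3 (devCoeff (quartic a b c) s 1) := by
    intro m hm h0
    rw [← hdev₁] at hm
    exact ((padicValInt_dvd_iff (p := 3) m _).1 (by exact_mod_cast hm)).resolve_left h0
  rcases Nat.lt_or_ge n 2 with hn2 | hn2
  · obtain rfl : n = 1 := by omega
    obtain ⟨b₁, hb₁⟩ := hd₁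
    have hY := H.newtonOrdinate_zero_three (by norm_num) (fun h0 => by
      have := hle 1 ⟨b₁, by rw [hb₁]; ring⟩ h0; omega)
    refine ⟨H.isRegularAt_of_one_side one_pos (by norm_num) (fun h0 => by
      have := hle 1 ⟨b₁, by rw [hb₁]; ring⟩ h0; omega) (by norm_num), (0 : ℕ), (0 : ℕ), ?_, ?_,
      isPIntegralBasis_of_slope_one_third hf hθ hK hs hc (by rw [h₀, pow_one]) hb₁ h₂ he3,
      by omega⟩
    · rw [hY _ (by norm_num)]; norm_num
    · rw [hY _ (by norm_num)]; norm_num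
  by_cases h9 : 9 ∣ 4 * s ^ 3 + 2 * a * s + b
  · rcases Nat.lt_or_ge n 3 with hn3 | hn3
    · obtain rfl : n = 2 := by omega
      obtain ⟨b₁, hb₁⟩ := h9
      have hY := H.newtonOrdinate_zero_three (by norm_num) (fun h0 => by
        have := hle 2 ⟨b₁, by rw [hb₁]; ring⟩ h0; omega)
      refine ⟨H.isRegularAt_of_one_side two_pos (by norm_num) (fun h0 => by
        have := hle 2 ⟨b₁, by rw [hb₁]; ring⟩ h0; omega) (by norm_num), (1 : ℕ), (0 : ℕ), ?_, ?_,
        isPIntegralBasis_of_slope_two_thirds hf hθ hK hs hc (by rw [h₀]; norm_num) hb₁ h₂ he3,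
        by omega⟩
      · rw [hY _ (by norm_num)]; norm_num
      · rw [hY _ (by norm_num)]; norm_num
    · obtain ⟨k, rfl⟩ : ∃ k, n = k + 3 := ⟨n - 3, by omega⟩
      -- With v(f(s)) ≥ 3 and 9 ∣ f'(s), the choice s = -b contradicts the first case, so s comes
      -- from the second.
      have hgood : IsGoodLift a b c s := by
        rcases hcase with ⟨h | h, rfl⟩ | ⟨-, h⟩
        · rw [hval₀] at h
          have : k + 3 ≤ 2 := by exact_mod_cast h
          omega
        · exact absurd h (by rw [hval₁, hder, not_not]; exact h9)
        · exact h
      obtain ⟨m, ⟨u, hu⟩, hm⟩ := exists_pow_dvd_of_isGoodLift hgood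
        (discr_quartic_ne_zero hf hθ hK) h₀ h9 h₂
      obtain ⟨D, hD, hD3⟩ := exists_discr_of_lt_two_mul hs h₀ hu h₂ he3 hw hm
      have hΔ : discVal a b c = k + 6 := by
        rw [discVal, hD, padicValInt_three_pow_mul hD3]
      have h₁ := hle m ⟨u, hu⟩
      have hY := H.newtonOrdinate_zero_two hn3 (fun h0 => by have := h₁ h0; omega)
      refine ⟨?_, ((k + 4) / 2 : ℕ), (1 : ℕ), ?_, ?_,
        isPIntegralBasis_of_lt_two_mul hf hθ hK hs h₀ hu h₂ he3 hw hm, by omega⟩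
      · rcases Nat.lt_or_ge 3 (k + 3) with hk | hk
        · exact H.isRegularAt_of_vertex_two hk (fun h0 => by have := h₁ h0; omega)
        · exact H.isRegularAt_of_one_side hn0 hk (fun h0 => by have := h₁ h0; omega)
            (fun _ h0 => by have := h₁ h0; omega)
      -- The ordinate at 1 is (n + 1)/2 = (k + 4)/2, and Δ = k + 6 makes its floor equal to ⌊Δ/2⌋ -
      -- 1.
      · rw [hY _ (by norm_num), eq_comm, Int.floor_eq_iff]
        have hdiv := Nat.div_add_mod (k + 4) 2
        have hmod := Nat.mod_lt (k + 4) two_pos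
        generalize (k + 4) / 2 = q at hdiv
        generalize (k + 4) % 2 = r at hdiv hmod
        have hdiv' : (2 : ℝ) * q + r = k + 4 := by exact_mod_cast hdiv
        have hr : (r : ℝ) < 2 := by exact_mod_cast hmod
        have hr0 : (0 : ℝ) ≤ r := Nat.cast_nonneg _
        push_cast
        constructor <;> linarith
      · rw [hY _ (by norm_num)]
        have : ((k + 3 : ℕ) : ℝ) + (1 - (k + 3 : ℕ)) / 2 * 2 = ((1 : ℤ) : ℝ) := by
          push_cast; ring
        rw [this, Int.floor_intCast]
        rfl
  · obtain ⟨u, hu⟩ := hd₁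
    have hu3 : ¬ (3 : ℤ) ∣ u := by omega
    have h1 : devCoeff (quartic a b c) s 1 ≠ 0 := by rw [hdev₁, hu]; omega
    have hv1 : padicValInt 3 (devCoeff (quartic a b c) s 1) = 1 := by
      rw [hdev₁, hu]
      simpa using padicValInt_three_pow_mul (k := 1) hu3
    have hY := H.newtonOrdinate_one_three hn2 h1 hv1
    obtain ⟨k, rfl⟩ : ∃ k, n = k + 2 := ⟨n - 2, by omega⟩
    rw [eval_quartic] at hne
    refine ⟨H.isRegularAt_of_vertex_one hn2 h1 hv1, (1 : ℕ), (0 : ℕ), ?_, ?_,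
      isPIntegralBasis_of_val_derivative_eq_one hf hθ hK hs hne (v := 3 ^ k * e)
        (by rw [h₀]; ring) hu h₂ hu3, by omega⟩
    · rw [hY _ (by norm_num)]; norm_num
    · rw [hY _ (by norm_num)]; norm_num
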